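/- **Proposition 1.1.** Let $M$ be a complex manifold of dimension $n$, $\pi:E\to M$ a holomorphic vector bundle of rank $m$, and $(E,[\cdot,\cdot]_E,\rho)$ a holomorphic Lie algebroid: $\rho:E\to T'M$ is a holomorphic bundle morphism and $[\cdot,\cdot]_E$ a Lie bracket on (local) holomorphic sections of $E$ with $[s_1,fs_2]_E=f[s_1,s_2]_E+\rho(s_1)(f)s_2$ for holomorphic $f$. The *complexified prolongation* $\mathcal T_{\mathbb C}E$ has as fibre over $u\in E$ the space of pairs $(e,v)\in (E_{\pi(u)})_{\mathbb C}\times T_{\mathbb C,u}E$ with $\rho_{\mathbb C}(e)=\pi_{*,\mathbb C}(v)$, where $\rho_{\mathbb C}$ and $\pi_{*,\mathbb C}$ are the $\mathbb C$-linear extensions of $\rho$ and $\pi_*$ to the complexifications $E_{\mathbb C}=E'\oplus E''$ and $T_{\mathbb C}E=T'E\oplus T''E$. Its bracket $[\cdot,\cdot]_{\mathcal T}$ is the $\mathbb C$-bilinear extension of the bracket on real smooth sections $(s,X)$ (where $s$ is a smooth section of $\pi^*E$ and $X$ a smooth vector field on the real manifold $E$ with $\pi_*X=\rho(s)$) determined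 by $[(\sigma\circ\pi,X),(\tau\circ\pi,Y)]=([\sigma,\tau]_E\circ\pi,[X,Y])$ for local holomorphic sections $\sigma,\tau$ of $E$, together with skew-symmetry and the Leibniz rule $[Z,fW]=f[Z,W]+X(f)W$ for $Z=(s,X)$ and smooth real $f$. Let $(z^k)$ be a holomorphic chart on an open set $U\subset M$, $\{e_\alpha\}_{\alpha=1}^m$ a holomorphic frame of $E$ on $U$, and $(z^k,u^\alpha)$ the induced coordinates on $\pi^{-1}(U)$, $u=u^\alpha e_\alpha$. Define holomorphic functions on $U$ by $\rho(e_\alpha)=\rho^k_\alpha\,\partial/\partial z^k$ and $[e_\alpha,e_\beta]_E=\mathcal C^{\gamma}_{\alpha\beta}e_\gamma$, and sections over $\pi^{-1}(U)$ by $$\mathcal Z_\alpha(u)=\Big(e_\alpha(\pi(u)),\ \rho^k_\alpha\frac{\partial}{\partial z^k}\Big|_u\Big),\qquad \mathcal V_\alpha(u)=\Big(0,\ \frac{\partial}{\partial u^\alpha}\Big|_u\Big),\qquad \mathcal Z_{\bar\alpha}=\overline{\mathcal Z_\alpha},\quad \mathcal V_{\bar\alpha}=\overline{\mathcal V_\alpha},$$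 where $E$ is identified with $E'$ by $e\mapsto\frac12(e-iJe)$, so that the first component of $\mathcal Z_\alpha$ lies in $E'$. Then $\{\mathcal Z_\alpha,\mathcal V_\alpha,\mathcal Z_{\bar\alpha},\mathcal V_{\bar\alpha}\}$ is a basis of the fibre of $\mathcal T_{\mathbb C}E$ at every point of $\pi^{-1}(U)$, and on $\pi^{-1}(U)$, for all $\alpha,\beta$, $$[\mathcal Z_\alpha,\mathcal Z_\beta]_{\mathcal T}=\mathcal C^{\gamma}_{\alpha\beta}\mathcal Z_\gamma,\qquad [\mathcal Z_\alpha,\mathcal V_\beta]_{\mathcal T}=[\mathcal V_\alpha,\mathcal V_\beta]_{\mathcal T}=0,$$ $$[\mathcal Z_\alpha,\mathcal Z_{\bar\beta}]_{\mathcal T}=[\mathcal Z_\alpha,\mathcal V_{\bar\beta}]_{\mathcal T}=[\mathcal V_\alpha,\mathcal V_{\bar\beta}]_{\mathcal T}=0,$$ together with the conjugate relations $$[\mathcal Z_{\bar\alpha},\mathcal Z_{\bar\beta}]_{\mathcal T}=\overline{[\mathcal Z_\alpha,\mathcal Z_\beta]_{\mathcal T}}=\mathcal C^{\bar\gamma}_{\bar\alpha\bar\beta}\mathcal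 Z_{\bar\gamma},\quad \mathcal C^{\bar\gamma}_{\bar\alpha\bar\beta}:=\overline{\mathcal C^{\gamma}_{\alpha\beta}},\qquad [\mathcal Z_{\bar\alpha},\mathcal V_{\bar\beta}]_{\mathcal T}=[\mathcal V_{\bar\alpha},\mathcal V_{\bar\beta}]_{\mathcal T}=[\mathcal Z_{\bar\alpha},\mathcal Z_{\beta}]_{\mathcal T}=[\mathcal Z_{\bar\alpha},\mathcal V_{\beta}]_{\mathcal T}=[\mathcal V_{\bar\alpha},\mathcal V_{\beta}]_{\mathcal T}=0,$$ and the brackets of $\mathcal V_\alpha,\mathcal V_{\bar\alpha}$ with $\mathcal Z_\beta,\mathcal Z_{\bar\beta}$ (in this order) vanish as well. -/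

import Mathlib

open Bundle Set Filter Topology
open scoped Manifold ContDiff

noncomputable section

/-! ### Complexification of a real vector space -/

/-- The complexification `W ⊕ iW` of a real vector space `W`; `⟨a, b⟩` stands for `a + i b`. -/
@[ext]
structure Cplx (W : Type*) where
  re : W
  im : W

namespace Cplx

variable {W W' : Type*} [AddCommGroup W] [AddCommGroup W']

instance : Zero (Cplx W) := ⟨⟨0, 0⟩⟩
instance : Add (Cplx W) := ⟨fun x y => ⟨x.re + y.re, x.im + y.im⟩⟩
instance : Neg (Cplx W) := ⟨fun x => ⟨-x.re, -x.im⟩⟩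

@[simp] theorem zero_re : (0 : Cplx W).re = 0 := rfl
@[simp] theorem zero_im : (0 : Cplx W).im = 0 := rfl
@[simp] theorem add_re (x y : Cplx W) : (x + y).re = x.re + y.re := rfl
@[simp] theorem add_im (x y : Cplx W) : (x + y).im = x.im + y.im := rfl
@[simp] theorem neg_re (x : Cplx W) : (-x).re = -x.re := rfl
@[simp] theorem neg_im (x : Cplx W) : (-x).im = -x.im := rfl

instance : AddCommGroup (Cplx W) where
  add_assoc x y z := by ext <;> simp [add_assoc]
  zero_add x := by ext <;> simp
  add_zero x := by ext <;> simp
  neg_add_cancel x := by ext <;> simp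
  add_comm x y := by ext <;> simp [add_comm]
  nsmul := nsmulRec
  zsmul := zsmulRec

variable [Module ℝ W] [Module ℝ W']

instance : SMul ℂ (Cplx W) :=
  ⟨fun c x => ⟨c.re • x.re - c.im • x.im, c.re • x.im + c.im • x.re⟩⟩

@[simp] theorem smul_re (c : ℂ) (x : Cplx W) : (c • x).re = c.re • x.re - c.im • x.im := rfl
@[simp] theorem smul_im (c : ℂ) (x : Cplx W) : (c • x).im = c.re • x.im + c.im • x.re := rfl

instance : Module ℂ (Cplx W) where
  one_smul x := by ext <;> simp
  mul_smul c d x := by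
    ext
    · simp only [smul_re, smul_im, Complex.mul_re, Complex.mul_im]; module
    · simp only [smul_re, smul_im, Complex.mul_re, Complex.mul_im]; module
  smul_zero c := by ext <;> simp
  smul_add c x y := by
    ext
    · simp only [smul_re, add_re, add_im]; module
    · simp only [smul_im, add_re, add_im]; module
  add_smul c d x := by
    ext
    · simp only [smul_re, add_re, Complex.add_re, Complex.add_im]; module
    · simp only [smul_im, add_im, Complex.add_re, Complex.add_im]; module
  zero_smul x := by ext <;> simp

/-- Complex conjugation `a + i b ↦ a - i b`. -/
def conj (x : Cplx W) : Cplx W := ⟨x.re, -x.im⟩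

/-- The `ℂ`-linear extension of a real linear map. -/
def map (f : W →ₗ[ℝ] W') : Cplx W →ₗ[ℂ] Cplx W' where
  toFun x := ⟨f x.re, f x.im⟩
  map_add' x y := by ext <;> simp
  map_smul' c x := by ext <;> simp

/-- For a complex vector space `W` with complex structure `J w = i w`, the identification of `W`
with the `(1,0)`-part of its complexification: `w ↦ w' = (w - i J w) / 2`. -/
def hol {W : Type*} [AddCommGroup W] [Module ℂ W] (w : W) : Cplx W :=
  ⟨(1 / 2 : ℝ) • w, -((1 / 2 : ℝ) • (Complex.I • w))⟩

end Cplx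

/-! ### Holomorphic Lie algebroids -/

/-- The model space of an `n`-dimensional complex manifold (also the typical fibre of a
vector bundle of rank `n`). -/
abbrev CModel (n : ℕ) : Type := Fin n → ℂ

/-- The model with corners of the complex manifold `E` (total space of a bundle of rank `m`
over a manifold of dimension `n`). -/
abbrev totalModelC (n m : ℕ) :
    ModelWithCorners ℂ (CModel n × CModel m) (ModelProd (CModel n) (CModel m)) :=
  𝓘(ℂ, CModel n).prod 𝓘(ℂ, CModel m)

/-- The model with corners of the underlying real manifold of `E`. -/
abbrev totalModelR (n m : ℕ) :
    ModelWithCorners ℝ (CModel n × CModel m) (ModelProd (CModel n) (CModel m)) :=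
  𝓘(ℝ, CModel n).prod 𝓘(ℝ, CModel m)

section Algebroid

variable {n m : ℕ} {M : Type*} [TopologicalSpace M] [ChartedSpace (CModel n) M]
  [IsManifold 𝓘(ℂ, CModel n) ω M] {E : M → Type*} [TopologicalSpace (TotalSpace (CModel m) E)]
  [∀ x, AddCommGroup (E x)] [∀ x, Module ℂ (E x)] [∀ x, TopologicalSpace (E x)]
  [FiberBundle (CModel m) E]

variable (n m) in
/-- The section `s` of `E` is holomorphic (complex analytic) near `x`. -/
def IsHolAt (s : ∀ x, E x) (x : M) : Prop :=
  ContMDiffAt 𝓘(ℂ, CModel n) (totalModelC n m) ω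
    (fun y => (⟨y, s y⟩ : TotalSpace (CModel m) E)) x

/-- The derivative of a function `f : M → ℂ` at `x` in the direction of a holomorphic tangent
vector `v`. -/
def holDeriv (f : M → ℂ) (x : M) (v : TangentSpace 𝓘(ℂ, CModel n) x) : ℂ :=
  mfderiv 𝓘(ℂ, CModel n) 𝓘(ℂ) f x v

variable (n m M E) in
/-- A holomorphic Lie algebroid structure on a holomorphic vector bundle `E` of rank `m` over a
complex manifold `M` of dimension `n`: a holomorphic bundle morphism `anchor : E → T'M` and a Lie
bracket on (local) holomorphic sections satisfying the Leibniz rule. A bracket on the sheaf of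
holomorphic sections is encoded by its values `bracket s t x`; these matter only where `s` and `t`
are holomorphic near `x`, and depend only on the germs of `s` and `t` at `x`. -/
structure HolLieAlgebroid where
  anchor : ∀ x : M, E x →ₗ[ℂ] TangentSpace 𝓘(ℂ, CModel n) x
  anchor_hol : ContMDiff (totalModelC n m) 𝓘(ℂ, CModel n).tangent ω
    (fun u : TotalSpace (CModel m) E =>
      (⟨u.proj, anchor u.proj u.2⟩ : TangentBundle 𝓘(ℂ, CModel n) M))
  bracket : (∀ x, E x) → (∀ x, E x) → (∀ x, E x)
  bracket_congr : ∀ (s s' t t' : ∀ x, E x) (x : M), IsHolAt n m s x → IsHolAt n m t x →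
    (∀ᶠ y in 𝓝 x, s y = s' y) → (∀ᶠ y in 𝓝 x, t y = t' y) → bracket s t x = bracket s' t' x
  bracket_hol : ∀ (s t : ∀ x, E x) (x : M), IsHolAt n m s x → IsHolAt n m t x →
    IsHolAt n m (bracket s t) x
  bracket_add : ∀ (s t t' : ∀ x, E x) (x : M),
    IsHolAt n m s x → IsHolAt n m t x → IsHolAt n m t' x →
    bracket s (t + t') x = bracket s t x + bracket s t' x
  bracket_smul : ∀ (c : ℂ) (s t : ∀ x, E x) (x : M), IsHolAt n m s x → IsHolAt n m t x →
    bracket s (c • t) x = c • bracket s t x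
  bracket_skew : ∀ (s t : ∀ x, E x) (x : M), IsHolAt n m s x → IsHolAt n m t x →
    bracket s t x = -bracket t s x
  jacobi : ∀ (s t r : ∀ x, E x) (x : M), IsHolAt n m s x → IsHolAt n m t x → IsHolAt n m r x →
    bracket s (bracket t r) x + bracket t (bracket r s) x + bracket r (bracket s t) x = 0
  leibniz : ∀ (f : M → ℂ) (s t : ∀ x, E x) (x : M),
    ContMDiffAt 𝓘(ℂ, CModel n) 𝓘(ℂ) ω f x → IsHolAt n m s x → IsHolAt n m t x →
    bracket s (fun y => f y • t y) x
      = f x • bracket s t x + holDeriv f x (anchor x (s x)) • t x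

/-! ### The complexified prolongation

The tangent space of the complex manifold `E` at `u` is a complex vector space; its elements are
also the tangent vectors at `u` of the underlying real manifold, multiplication by `i` being the
complex structure `J`. So `Cplx (TangentSpace (totalModelC n m) u)` is the complexified tangent
space `T_ℂ E` at `u`, and similarly for `T_ℂ M`. -/

variable (n m E) in
/-- The fibre at `u` of `E_ℂ × T_ℂ E`. -/
abbrev AmbientFibre (u : TotalSpace (CModel m) E) : Type _ :=
  Cplx (E u.proj) × Cplx (TangentSpace (totalModelC n m) u)

variable (n m E) in
/-- The tangent map at `u` of the bundle projection `π : E → M`. -/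
def projDeriv (u : TotalSpace (CModel m) E) :
    TangentSpace (totalModelC n m) u →ₗ[ℂ] TangentSpace 𝓘(ℂ, CModel n) u.proj :=
  (mfderiv (totalModelC n m) 𝓘(ℂ, CModel n)
    (fun w : TotalSpace (CModel m) E => w.proj) u).toLinearMap

namespace HolLieAlgebroid

variable (L : HolLieAlgebroid n m M E)

/-- The fibre at `u` of the complexified prolongation of `E`: all pairs `(e, v)` in
`E_ℂ × T_ℂ E` over `u` with `ρ_ℂ(e) = π_{*,ℂ}(v)`. -/
def prolongation (u : TotalSpace (CModel m) E) : Submodule ℂ (AmbientFibre n m E u) :=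
  LinearMap.ker
    ((Cplx.map ((L.anchor u.proj).restrictScalars ℝ)).comp
        (LinearMap.fst ℂ (Cplx (E u.proj)) (Cplx (TangentSpace (totalModelC n m) u)))
      - (Cplx.map ((projDeriv n m E u).restrictScalars ℝ)).comp
        (LinearMap.snd ℂ (Cplx (E u.proj)) (Cplx (TangentSpace (totalModelC n m) u))))

end HolLieAlgebroid

/-- The map `TotalSpace → F` representing `s`, a section of the pullback of `E` along `π`, in the
distinguished trivialization of `E` around `b`. -/
def fibreCoord (b : M) (s : ∀ u : TotalSpace (CModel m) E, E u.proj) :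
    TotalSpace (CModel m) E → CModel m :=
  fun u => (trivializationAt (CModel m) E b ⟨u.proj, s u⟩).2

/-- The derivative of a smooth vector valued function `g` on the real manifold `E` at `u` in the
direction of a real tangent vector `v`. -/
def realDeriv (g : TotalSpace (CModel m) E → CModel m) (u : TotalSpace (CModel m) E)
    (v : TangentSpace (totalModelC n m) u) : CModel m :=
  mfderiv (totalModelR n m) 𝓘(ℝ, CModel m) g u v

namespace HolLieAlgebroid

variable (L : HolLieAlgebroid n m M E)

/-- The bracket at `b` of the sections of `E` that are constant, equal to `a` and to `a'`, in the
distinguished trivialization around `b` (expressed in that trivialization). In terms of the frame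
`ε_α` given by this trivialization it is `C^γ_{αβ}(b) a^α a'^β`. -/
def constBracket (b : M) (a a' : CModel m) : CModel m :=
  (trivializationAt (CModel m) E b ⟨b, L.bracket
    (fun x => (trivializationAt (CModel m) E b).symm x a)
    (fun x => (trivializationAt (CModel m) E b).symm x a') b⟩).2

/-- The bracket of two real sections `(s, X)`, `(t, Y)` of the prolongation (`s`, `t` sections of
`π^*E`, `X`, `Y` vector fields on the real manifold `E`, with `π_* X = ρ(s)`, `π_* Y = ρ(t)`).

It is the bracket determined by the Leibniz rule `[Z, f W] = f [Z, W] + ρ_𝒯(Z)(f) W` and by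
`[(σ ∘ π, X), (τ ∘ π, Y)] = ([σ, τ] ∘ π, [X, Y])` for holomorphic sections `σ`, `τ` of `E`.
Explicitly: the second component is the Lie bracket of vector fields `[X, Y]`, and if
`s = s^α ε_α`, `t = t^α ε_α` in the distinguished holomorphic frame around `π(u)`,
then the first component at `u` is `(X(t^γ) - Y(s^γ) + C^γ_{αβ} s^α t^β) ε_γ`. -/
def realBracket (s t : ∀ u : TotalSpace (CModel m) E, E u.proj)
    (X Y : ∀ u : TotalSpace (CModel m) E, TangentSpace (totalModelC n m) u)
    (u : TotalSpace (CModel m) E) : E u.proj × TangentSpace (totalModelC n m) u :=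
  ((trivializationAt (CModel m) E u.proj).symm u.proj
      (realDeriv (fibreCoord u.proj t) u (X u) - realDeriv (fibreCoord u.proj s) u (Y u)
        + L.constBracket u.proj (fibreCoord u.proj s u) (fibreCoord u.proj t u)),
    VectorField.mlieBracket (totalModelR n m) X Y u)

/-- The bracket `[Z, W]_𝒯` of two sections of the complexified prolongation: the `ℂ`-bilinear
extension of the bracket of real sections. -/
def prolongBracket (Z W : ∀ u : TotalSpace (CModel m) E, AmbientFibre n m E u)
    (u : TotalSpace (CModel m) E) : AmbientFibre n m E u :=
  let rr := L.realBracket (fun u => (Z u).1.re) (fun u => (W u).1.re)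
    (fun u => (Z u).2.re) (fun u => (W u).2.re) u
  let ii := L.realBracket (fun u => (Z u).1.im) (fun u => (W u).1.im)
    (fun u => (Z u).2.im) (fun u => (W u).2.im) u
  let ri := L.realBracket (fun u => (Z u).1.re) (fun u => (W u).1.im)
    (fun u => (Z u).2.re) (fun u => (W u).2.im) u
  let ir := L.realBracket (fun u => (Z u).1.im) (fun u => (W u).1.re)
    (fun u => (Z u).2.im) (fun u => (W u).2.re) u
  (⟨rr.1 - ii.1, ri.1 + ir.1⟩, ⟨rr.2 - ii.2, ri.2 + ir.2⟩)

end HolLieAlgebroid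

/-- Conjugation on `E_ℂ × T_ℂ E`. -/
def conjFibre {u : TotalSpace (CModel m) E} (p : AmbientFibre n m E u) : AmbientFibre n m E u :=
  (p.1.conj, p.2.conj)

/-! ### Local coordinates and the natural local basis

`φ` is a complex chart of `M` with coordinates `z^k`, and `e_α` a holomorphic frame of `E` on the
domain of `φ`. -/

section Frame

variable (φ : OpenPartialHomeomorph M (CModel n)) (e : Fin m → ∀ x, E x)

/-- The local parametrization of `E` with coordinates `(z^k, u^α)`. -/
def bundleParam (p : CModel n × CModel m) : TotalSpace (CModel m) E :=
  ⟨φ.symm p.1, ∑ α, p.2 α • e α (φ.symm p.1)⟩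

variable {φ e} in
/-- The coordinates `(z^k, u^α)` of a point `u = u^α e_α` of `E` over the domain of `φ`. -/
def bundleCoord (he : IsLocalFrameOn 𝓘(ℂ, CModel n) (CModel m) ω e φ.source)
    (u : TotalSpace (CModel m) E) : CModel n × CModel m :=
  (φ u.proj, fun α => he.coeff α u.proj u.2)

variable {φ e}
variable (he : IsLocalFrameOn 𝓘(ℂ, CModel n) (CModel m) ω e φ.source)

/-- The holomorphic tangent vector `∂/∂z^k` of `E` at `u` in the coordinates `(z^k, u^α)`. -/
def partialZ (k : Fin n) (u : TotalSpace (CModel m) E) : TangentSpace (totalModelC n m) u :=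
  mfderiv 𝓘(ℂ, CModel n × CModel m) (totalModelC n m) (bundleParam φ e) (bundleCoord he u)
    ((Pi.single k 1, 0) : CModel n × CModel m)

/-- The holomorphic tangent vector `∂/∂u^α` of `E` at `u` in the coordinates `(z^k, u^α)`. -/
def partialU (α : Fin m) (u : TotalSpace (CModel m) E) : TangentSpace (totalModelC n m) u :=
  mfderiv 𝓘(ℂ, CModel n × CModel m) (totalModelC n m) (bundleParam φ e) (bundleCoord he u)
    ((0, Pi.single α 1) : CModel n × CModel m)

namespace HolLieAlgebroid

variable (L : HolLieAlgebroid n m M E)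

variable (φ e) in
/-- The anchor coefficients `ρ^k_α`, defined by `ρ(e_α) = ρ^k_α ∂/∂z^k`. -/
def anchorCoeff (α : Fin m) (k : Fin n) (x : M) : ℂ :=
  (mfderiv 𝓘(ℂ, CModel n) 𝓘(ℂ, CModel n) φ x (L.anchor x (e α x)) : CModel n) k

/-- The structure functions `C^γ_{αβ}`, defined by `[e_α, e_β] = C^γ_{αβ} e_γ`. -/
def structureFn (α β γ : Fin m) (x : M) : ℂ :=
  he.coeff γ x (L.bracket (e α) (e β) x)

/-- `𝒵_α(u) = (e_α(π(u)), ρ^k_α ∂/∂z^k)`. -/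
def secZ (α : Fin m) (u : TotalSpace (CModel m) E) : AmbientFibre n m E u :=
  (Cplx.hol (e α u.proj),
    ∑ k, L.anchorCoeff φ e α k u.proj • Cplx.hol (partialZ he k u))

/-- The conjugate `𝒵_ᾱ` of `𝒵_α`. -/
def secZbar (α : Fin m) (u : TotalSpace (CModel m) E) : AmbientFibre n m E u :=
  conjFibre (L.secZ he α u)

end HolLieAlgebroid

/-- `𝒱_α(u) = (0, ∂/∂u^α)`. -/
def secV (α : Fin m) (u : TotalSpace (CModel m) E) : AmbientFibre n m E u :=
  (0, Cplx.hol (partialU he α u))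

/-- The conjugate `𝒱_ᾱ` of `𝒱_α`. -/
def secVbar (α : Fin m) (u : TotalSpace (CModel m) E) : AmbientFibre n m E u :=
  conjFibre (secV he α u)

/-- The natural local frame `{𝒵_α, 𝒱_α, 𝒵_ᾱ, 𝒱_ᾱ}` of the complexified prolongation, at `u`. -/
def HolLieAlgebroid.naturalFrame (L : HolLieAlgebroid n m M E) (u : TotalSpace (CModel m) E) :
    (Fin m ⊕ Fin m) ⊕ (Fin m ⊕ Fin m) → AmbientFibre n m E u :=
  Sum.elim (Sum.elim (fun α => L.secZ he α u) (fun α => secV he α u))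
    (Sum.elim (fun α => L.secZbar he α u) (fun α => secVbar he α u))

end Frame

end Algebroid

end

/-! Brackets. The pairs `(e_α ∘ π, ρ^k_α ∂/∂z^k)` and `(0, ∂/∂u^α)` are holomorphic in the sense of
`IsHolPair`. The derivative of a holomorphic map is complex linear, so for such pairs the real
bracket is compatible with constant complex scalars acting through the complex structures
(`realBracket_smul_smul`). A (1,0)-lift has the form `(Z - i JZ) / 2` and its conjugate the form `(Z
+ i JZ) / 2`. Expanding bilinearly, the bracket of two (1,0)-lifts is the (1,0)-lift of the real
bracket, mixed brackets cancel, and conjugation commutes with the bracket. Every relation is thereby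
reduced to the real brackets of the pairs above.

For the first component of these brackets, `bracket_eq_constBracket` expands `[σ, τ]` in the
distinguished trivialization and finds the formula used in `realBracket`; `realBracket_fst` then
gives `[σ, τ] ∘ π` as soon as the vector fields project to the anchors.

The second component is computed in the coordinates `(z^k, u^α)` by `mlieBracket_coordField`. The
field `ρ^k_α ∂/∂z^k` does not depend on `u` and `∂/∂u^α` is constant, so only the bracket of two
fields of the first kind survives. Its value is governed by `ρ([s, t]) = [ρ(s), ρ(t)]`, which is not
an axiom here: `holDeriv_anchor_bracket` extracts it from the Jacobi identity for `s, t, f r` and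
the Leibniz rule, given a section `r` not vanishing at the point.

Basis. A complexified complex vector space is the direct sum of its (1,0) and (0,1) parts, and the
complex linear maps `ρ` and `π_*` respect this splitting. It is therefore enough to treat pairs `(x,
v)` with `ρ(x) = π_* v`: the frame coefficients of `x` give those of the `𝒵_α`, and the remaining
part of `v` is vertical, hence a unique combination of the `∂/∂u^α`. -/

set_option linter.unusedSectionVars false

/-! ### Passing from a complex manifold to the underlying real manifold -/

section RestrictScalars

variable {V H N V' H' N' : Type*}
  [NormedAddCommGroup V] [NormedSpace ℂ V] [NormedSpace ℝ V] [IsScalarTower ℝ ℂ V]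
  [TopologicalSpace H]
  [TopologicalSpace N] [ChartedSpace H N]
  [NormedAddCommGroup V'] [NormedSpace ℂ V'] [NormedSpace ℝ V'] [IsScalarTower ℝ ℂ V']
  [TopologicalSpace H']
  [TopologicalSpace N'] [ChartedSpace H' N']
  {I : ModelWithCorners ℂ V H} {J : ModelWithCorners ℝ V H}
  {I' : ModelWithCorners ℂ V' H'} {J' : ModelWithCorners ℝ V' H'}

/-- A complex manifold is a manifold over `ℝ`. -/
theorem IsManifold.restrictScalars_real (h : I.toPartialEquiv = J.toPartialEquiv)
    {k : ℕ∞ω} [IsManifold I k N] : IsManifold J k N := by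
  apply isManifold_of_contDiffOn
  intro e e' he he'
  have h1 : (I : H → V) = J := congrArg (fun q : PartialEquiv H V => (q : H → V)) h
  have h2 : (I.symm : V → H) = J.symm :=
    congrArg (fun q : PartialEquiv H V => (q.symm : V → H)) h
  have := (contDiffGroupoid k I).compatible he he'
  rw [contDiffGroupoid, mem_groupoid_of_pregroupoid] at this
  have h3 := this.1
  simp only [contDiffPregroupoid, h1, h2] at h3
  exact h3.restrict_scalars ℝ

/-- The two models live over different fields, so they can only be compared through their underlying
partial equivalences. Once these agree, the chart expressions of `f` are the same map, and only its
differentiability has to be restricted to `ℝ`. -/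
theorem ContMDiffAt.restrictScalars_real (h : I.toPartialEquiv = J.toPartialEquiv)
    (h' : I'.toPartialEquiv = J'.toPartialEquiv) {k : ℕ∞ω} {f : N → N'} {x : N}
    (hf : ContMDiffAt I I' k f x) : ContMDiffAt J J' k f x := by
  rw [contMDiffAt_iff] at hf ⊢
  refine ⟨hf.1, ?_⟩
  have := hf.2.restrict_scalars ℝ
  have h1 : (I : H → V) = J := congrArg (fun q : PartialEquiv H V => (q : H → V)) h
  simpa only [extChartAt, OpenPartialHomeomorph.extend, h, h', h1] using this

theorem HasMFDerivAt.restrictScalars_real (h : I.toPartialEquiv = J.toPartialEquiv)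
    (h' : I'.toPartialEquiv = J'.toPartialEquiv) {f : N → N'} {x : N} {f' : V →L[ℂ] V'}
    (hf : HasMFDerivAt I I' f x f') : HasMFDerivAt J J' f x (f'.restrictScalars ℝ) := by
  refine ⟨hf.1, ?_⟩
  have := HasFDerivWithinAt.restrictScalars ℝ hf.2
  have h1 : (I : H → V) = J := congrArg (fun q : PartialEquiv H V => (q : H → V)) h
  simp only [writtenInExtChartAt, extChartAt, OpenPartialHomeomorph.extend, h, h', h1] at this ⊢
  exact this

end RestrictScalars

theorem totalModel_toPartialEquiv (n m : ℕ) :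
    (totalModelC n m).toPartialEquiv = (totalModelR n m).toPartialEquiv := rfl

theorem VectorField.mlieBracket_eq_lieBracket {F : Type*} [NormedAddCommGroup F] [NormedSpace ℝ F]
    {V W : ∀ x : F, TangentSpace 𝓘(ℝ, F) x} :
    VectorField.mlieBracket 𝓘(ℝ, F) V W = VectorField.lieBracket ℝ V W := by
  rw [← VectorField.mlieBracketWithin_univ, VectorField.mlieBracketWithin_eq_lieBracketWithin]
  exact VectorField.lieBracketWithin_univ

/-! ### The (1,0) and (0,1) parts of the complexification -/

namespace Cplx

variable {W : Type*} [AddCommGroup W] [Module ℂ W]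

/-- The element `a w + i b w` of the complexification of a complex vector space `W`, where `a w`
and `b w` are formed in `W`. -/
noncomputable def ofScalars (a b : ℂ) (w : W) : Cplx W := ⟨a • w, b • w⟩

/-- With real and imaginary components both written as complex multiples of the same `w`, the
complex homogeneity of the real bracket can be applied to each component. -/
theorem hol_eq_ofScalars (w : W) : hol w = ofScalars (1 / 2) (-(Complex.I / 2)) w := by
  ext
  · change (1 / 2 : ℝ) • w = (1 / 2 : ℂ) • w
    rw [← Complex.coe_smul]; norm_num
  · change -((1 / 2 : ℝ) • (Complex.I • w)) = (-(Complex.I / 2)) • w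
    rw [← Complex.coe_smul, smul_smul, ← neg_smul]
    congr 1
    push_cast
    ring

theorem conj_hol_eq_ofScalars (w : W) :
    (hol w).conj = ofScalars (1 / 2) (Complex.I / 2) w := by
  rw [hol_eq_ofScalars]
  ext
  · rfl
  · change -((-(Complex.I / 2)) • w) = (Complex.I / 2) • w
    rw [neg_smul, neg_neg]

/-- The identification of `W` with the `(1,0)`-part of its complexification as a linear map. -/
noncomputable def holₗ : W →ₗ[ℂ] Cplx W where
  toFun := hol
  map_add' x y := by
    simp only [hol_eq_ofScalars, ofScalars]
    ext <;> simp
  map_smul' c x := by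
    simp only [hol_eq_ofScalars, ofScalars]
    ext
    · simp only [smul_re, RingHom.id_apply, ← Complex.coe_smul, smul_smul, ← sub_smul]
      congr 1
      apply Complex.ext <;> simp <;> ring
    · simp only [smul_im, RingHom.id_apply, ← Complex.coe_smul, smul_smul, ← add_smul]
      congr 1
      apply Complex.ext <;> simp <;> ring

@[simp] theorem holₗ_apply (w : W) : holₗ w = hol w := rfl

theorem conj_add (x y : Cplx W) : (x + y).conj = x.conj + y.conj := by
  ext
  · rfl
  · change -(x.im + y.im) = -x.im + -y.im
    abel

theorem conj_smul (c : ℂ) (x : Cplx W) : (c • x).conj = (starRingEnd ℂ) c • x.conj := by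
  ext
  · simp [conj]
  · simp only [conj, smul_im, Complex.conj_re, Complex.conj_im]
    module

theorem conj_zero : (0 : Cplx W).conj = 0 := by
  ext <;> simp [conj]

theorem conj_sum {ι : Type*} (S : Finset ι) (x : ι → Cplx W) :
    (∑ i ∈ S, x i).conj = ∑ i ∈ S, (x i).conj := by
  classical
  induction S using Finset.induction_on with
  | empty => exact conj_zero
  | insert i S hi ih => rw [Finset.sum_insert hi, Finset.sum_insert hi, conj_add, ih]

/-- The two parts meet only in zero: the real component controls `x + y`, and the imaginary
component, multiplied by `i`, controls `x - y`. -/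
theorem eq_zero_of_hol_add_conj_hol {x y : W} (h : hol x + (hol y).conj = 0) : x = 0 ∧ y = 0 := by
  rw [conj_hol_eq_ofScalars, hol_eq_ofScalars] at h
  have h1 : (1 / 2 : ℂ) • x + (1 / 2 : ℂ) • y = 0 := congrArg re h
  have h2 : (-(Complex.I / 2)) • x + (Complex.I / 2) • y = 0 := congrArg im h
  have hI : Complex.I * (Complex.I / 2) = -(1 / 2) := by
    rw [← mul_div_assoc, Complex.I_mul_I]; norm_num
  have h3 : (1 / 2 : ℂ) • x - (1 / 2 : ℂ) • y = 0 := by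
    have := congrArg (Complex.I • ·) h2
    simp only [smul_add, smul_smul, mul_neg, hI, smul_zero, neg_neg] at this
    rwa [neg_smul, ← sub_eq_add_neg] at this
  constructor
  · linear_combination (norm := module) h1 + h3
  · linear_combination (norm := module) h1 - h3

theorem exists_hol_add_conj_hol (z : Cplx W) : ∃ x y : W, z = hol x + (hol y).conj := by
  -- The real component forces `x + y = 2 re z`, and the imaginary one `x - y = 2 i im z`.
  refine ⟨z.re + Complex.I • z.im, z.re - Complex.I • z.im, ?_⟩
  have hI : Complex.I / 2 * Complex.I = -(1 / 2) := by
    rw [div_mul_eq_mul_div, Complex.I_mul_I]; norm_num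
  rw [conj_hol_eq_ofScalars, hol_eq_ofScalars]
  ext
  · simp only [ofScalars, add_re]
    module
  · simp only [ofScalars, add_im, smul_add, smul_sub, smul_smul, neg_mul, hI]
    module

end Cplx

section ProlongationFrame

variable {n m : ℕ} {M : Type*} [TopologicalSpace M] [ChartedSpace (CModel n) M]
  [IsManifold 𝓘(ℂ, CModel n) ω M] {E : M → Type*} [TopologicalSpace (TotalSpace (CModel m) E)]
  [∀ x, AddCommGroup (E x)] [∀ x, Module ℂ (E x)] [∀ x, TopologicalSpace (E x)]
  [FiberBundle (CModel m) E] [VectorBundle ℂ (CModel m) E]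
  [ContMDiffVectorBundle ω (CModel m) E 𝓘(ℂ, CModel n)]

/-! ### The coordinates `(z^k, u^α)` -/

section Coordinates

variable {φ : OpenPartialHomeomorph M (CModel n)} {e : Fin m → ∀ x, E x}

theorem contMDiffAt_trivialization_snd_section {s : ∀ x, E x} {x b : M} (hs : IsHolAt n m s x)
    (hx : x ∈ (trivializationAt (CModel m) E b).baseSet) :
    ContMDiffAt 𝓘(ℂ, CModel n) 𝓘(ℂ, CModel m) ω
      (fun y => (trivializationAt (CModel m) E b ⟨y, s y⟩).2) x :=
  ((trivializationAt (CModel m) E b).contMDiffAt_section_iff (IB := 𝓘(ℂ, CModel n)) (n := ω)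
    hx).1 hs

theorem trivialization_sum_smul {b x : M}
    (hx : x ∈ (trivializationAt (CModel m) E b).baseSet) (a : Fin m → ℂ) (v : Fin m → E x) :
    (trivializationAt (CModel m) E b ⟨x, ∑ α, a α • v α⟩).2
      = ∑ α, a α • (trivializationAt (CModel m) E b ⟨x, v α⟩).2 := by
  have h := (trivializationAt (CModel m) E b).coe_linearMapAt_of_mem (R := ℂ) hx
  have h' : ∀ w : E x, (trivializationAt (CModel m) E b ⟨x, w⟩).2
      = (trivializationAt (CModel m) E b).linearMapAt ℂ x w := fun w => (congrFun h w).symm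
  simp only [h', map_sum, map_smul]

theorem IsLocalFrameOn.sum_coeff_smul {U : Set M}
    (he : IsLocalFrameOn 𝓘(ℂ, CModel n) (CModel m) ω e U) {x : M} (hx : x ∈ U) (v : E x) :
    ∑ α, he.coeff α x v • e α x = v := by
  classical
  simpa using (he.coeff_sum_eq (Function.update (fun _ => 0) x v) hx).symm

theorem IsLocalFrameOn.coeff_sum_smul {U : Set M}
    (he : IsLocalFrameOn 𝓘(ℂ, CModel n) (CModel m) ω e U) {x : M} (hx : x ∈ U)
    (a : Fin m → ℂ) (α : Fin m) : he.coeff α x (∑ β, a β • e β x) = a α := by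
  have h : ∑ β, a β • e β x = ∑ β, a β • he.toBasisAt hx β := by simp
  rw [IsLocalFrameOn.coeff, dif_pos hx, h, Module.Basis.coord_apply, Module.Basis.repr_sum_self]

theorem bundleParam_bundleCoord (he : IsLocalFrameOn 𝓘(ℂ, CModel n) (CModel m) ω e φ.source)
    {u : TotalSpace (CModel m) E} (hu : u.proj ∈ φ.source) :
    bundleParam φ e (bundleCoord he u) = u := by
  have h : ∀ y, y = u.proj →
      (⟨y, ∑ α, he.coeff α u.proj u.2 • e α y⟩ : TotalSpace (CModel m) E) = u := by
    rintro _ rfl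
    rw [he.sum_coeff_smul hu]
  exact h _ (φ.left_inv hu)

theorem bundleCoord_bundleParam (he : IsLocalFrameOn 𝓘(ℂ, CModel n) (CModel m) ω e φ.source)
    {p : CModel n × CModel m} (hp : p.1 ∈ φ.target) :
    bundleCoord he (bundleParam φ e p) = p :=
  Prod.ext (φ.right_inv hp) (funext fun α => he.coeff_sum_smul (φ.map_target hp) p.2 α)

/-- In the trivialization around the image point the fibre part is `∑ u^α ε_α(z)`, where `ε_α` is
the analytic coordinate vector of `e_α`. -/
theorem contMDiffAt_bundleParam (hφ : φ ∈ IsManifold.maximalAtlas 𝓘(ℂ, CModel n) ω M)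
    (he : IsLocalFrameOn 𝓘(ℂ, CModel n) (CModel m) ω e φ.source)
    {p : CModel n × CModel m} (hp : p.1 ∈ φ.target) :
    ContMDiffAt 𝓘(ℂ, CModel n × CModel m) (totalModelC n m) ω (bundleParam φ e) p := by
  have h1 : ContMDiffAt 𝓘(ℂ, CModel n × CModel m) 𝓘(ℂ, CModel n) ω
      (fun q : CModel n × CModel m => φ.symm q.1) p :=
    (contMDiffAt_symm_of_mem_maximalAtlas hφ hp).comp p contDiffAt_fst.contMDiffAt
  refine contMDiffAt_totalSpace.2 ⟨h1, ?_⟩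
  set b : M := (bundleParam φ e p).proj with hb
  have hbs : φ.symm p.1 ∈ (trivializationAt (CModel m) E b).baseSet :=
    mem_baseSet_trivializationAt (CModel m) E b
  have key : ContMDiffAt 𝓘(ℂ, CModel n × CModel m) 𝓘(ℂ, CModel m) ω
      (fun q : CModel n × CModel m => ∑ α, q.2 α •
        (trivializationAt (CModel m) E b ⟨φ.symm q.1, e α (φ.symm q.1)⟩).2) p := by
    refine ContMDiffAt.sum fun α _ => ?_
    refine ContMDiffAt.smul (f := fun q : CModel n × CModel m => q.2 α)
      (ContDiff.contMDiff (by fun_prop)).contMDiffAt ?_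
    exact ContMDiffAt.comp (g := fun x : M => (trivializationAt (CModel m) E b ⟨x, e α x⟩).2) p
      (contMDiffAt_trivialization_snd_section
        (he.contMDiffAt φ.open_source (φ.map_target hp) α) hbs) h1
  refine key.congr_of_eventuallyEq ?_
  filter_upwards [h1.continuousAt.preimage_mem_nhds
    ((trivializationAt (CModel m) E b).open_baseSet.mem_nhds hbs)] with q hq
  exact trivialization_sum_smul hq _ _

/-- The linear map whose columns are the vectors `v α`. -/
noncomputable def columnsMap (v : Fin m → CModel m) : CModel m →L[ℂ] CModel m :=
  ∑ α, (ContinuousLinearMap.proj (R := ℂ) (φ := fun _ : Fin m => ℂ) α).smulRight (v α)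

theorem columnsMap_apply (v : Fin m → CModel m) (a : CModel m) :
    columnsMap v a = ∑ α, a α • v α := by
  simp [columnsMap]

theorem contDiff_columnsMap : ContDiff ℂ ω (columnsMap (m := m)) := by
  refine ContDiff.sum fun α _ => ?_
  exact ((ContinuousLinearMap.smulRightL ℂ (CModel m) (CModel m)
    (ContinuousLinearMap.proj (R := ℂ) (φ := fun _ : Fin m => ℂ) α)).contDiff).comp
    (contDiff_apply ℂ (CModel m) α)

/-- The frame coefficients are obtained from the trivialization coordinates by inverting the matrix
`A` whose columns represent the frame. This matrix depends analytically on the base point, and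
inversion is analytic at an invertible operator. -/
theorem contMDiffAt_bundleCoord (hφ : φ ∈ IsManifold.maximalAtlas 𝓘(ℂ, CModel n) ω M)
    (he : IsLocalFrameOn 𝓘(ℂ, CModel n) (CModel m) ω e φ.source)
    {u : TotalSpace (CModel m) E} (hu : u.proj ∈ φ.source) :
    ContMDiffAt (totalModelC n m) 𝓘(ℂ, CModel n × CModel m) ω (bundleCoord he) u := by
  set T := trivializationAt (CModel m) E u.proj with hT
  have hb : u.proj ∈ T.baseSet := mem_baseSet_trivializationAt (CModel m) E u.proj
  have hproj : ContMDiffAt (totalModelC n m) 𝓘(ℂ, CModel n) ω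
      (fun w : TotalSpace (CModel m) E => w.proj) u := contMDiffAt_proj E
  have h1 : ContMDiffAt (totalModelC n m) 𝓘(ℂ, CModel n) ω
      (fun w : TotalSpace (CModel m) E => φ w.proj) u :=
    (contMDiffAt_of_mem_maximalAtlas hφ hu).comp u hproj
  let A : M → CModel m →L[ℂ] CModel m := fun x => columnsMap fun α => (T ⟨x, e α x⟩).2
  have hA : ContMDiffAt 𝓘(ℂ, CModel n) 𝓘(ℂ, CModel m →L[ℂ] CModel m) ω A u.proj := by
    refine (contDiff_columnsMap (m := m)).contMDiff.contMDiffAt.comp u.proj ?_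
    refine contMDiffAt_pi_space.2 fun α => ?_
    exact contMDiffAt_trivialization_snd_section (he.contMDiffAt φ.open_source hu α) hb
  have hAcoeff : ∀ w : TotalSpace (CModel m) E, w.proj ∈ φ.source → w.proj ∈ T.baseSet →
      A w.proj (fun α => he.coeff α w.proj w.2) = (T w).2 := by
    intro w hw hwT
    rw [columnsMap_apply, ← trivialization_sum_smul hwT]
    simp only [he.sum_coeff_smul hw]
    rfl
  have hAinv : (A u.proj).IsInvertible := by
    have hli : LinearIndependent ℂ fun α => (T ⟨u.proj, e α u.proj⟩).2 := by
      have := (he.linearIndependent hu).map'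
        (T.linearEquivAt ℂ u.proj hb : E u.proj →ₗ[ℂ] CModel m)
        (LinearEquiv.ker _)
      exact this
    have hinj : Function.Injective (A u.proj : CModel m →ₗ[ℂ] CModel m) := by
      rw [← LinearMap.ker_eq_bot, LinearMap.ker_eq_bot']
      intro a ha
      have := Fintype.linearIndependent_iff.1 hli a
        (by rw [← columnsMap_apply]; exact ha)
      exact funext this
    exact ⟨(LinearEquiv.ofInjectiveEndo _ hinj).toContinuousLinearEquiv, by ext1; rfl⟩
  have h2 : ContMDiffAt (totalModelC n m) 𝓘(ℂ, CModel m) ω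
      (fun w : TotalSpace (CModel m) E => (A w.proj).inverse (T w).2) u := by
    have hAi : ContMDiffAt (totalModelC n m) 𝓘(ℂ, CModel m →L[ℂ] CModel m) ω
        (fun w : TotalSpace (CModel m) E => (A w.proj).inverse) u :=
      (hAinv.contDiffAt_map_inverse.contMDiffAt).comp u (hA.comp u hproj)
    exact hAi.clm_apply (contMDiffAt_totalSpace.1 contMDiffAt_id).2
  refine (h1.prodMk_space h2).congr_of_eventuallyEq ?_
  -- Invertibility is an open condition, so the formula through the inverse matrix holds on a whole
  -- neighbourhood of `u`.
  have hev : ∀ᶠ x in 𝓝 u.proj, x ∈ φ.source ∧ x ∈ T.baseSet ∧ (A x).IsInvertible := by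
    refine (φ.open_source.eventually_mem hu).and ((T.open_baseSet.eventually_mem hb).and ?_)
    exact hA.continuousAt.eventually (ContinuousLinearEquiv.isOpen.mem_nhds hAinv)
  filter_upwards [hproj.continuousAt.eventually hev] with w hw
  refine Prod.ext rfl ?_
  change (fun α => he.coeff α w.proj w.2) = (A w.proj).inverse (T w).2
  exact (hw.2.2.inverse_apply_eq.2 (hAcoeff w hw.1 hw.2.1).symm).symm

end Coordinates

/-! ### Lie brackets of holomorphic vector fields on the total space -/

section CoordinateFields

variable {φ : OpenPartialHomeomorph M (CModel n)} {e : Fin m → ∀ x, E x}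

variable (m E) in
theorem isManifold_totalModelR :
    IsManifold (totalModelR n m) ω (TotalSpace (CModel m) E) :=
  IsManifold.restrictScalars_real (totalModel_toPartialEquiv n m)

theorem mfderiv_bundleParam_mfderiv_bundleCoord
    (hφ : φ ∈ IsManifold.maximalAtlas 𝓘(ℂ, CModel n) ω M)
    (he : IsLocalFrameOn 𝓘(ℂ, CModel n) (CModel m) ω e φ.source)
    {u : TotalSpace (CModel m) E} (hu : u.proj ∈ φ.source) (v : CModel n × CModel m) :
    (mfderiv 𝓘(ℂ, CModel n × CModel m) (totalModelC n m) (bundleParam φ e) (bundleCoord he u)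
      (mfderiv (totalModelC n m) 𝓘(ℂ, CModel n × CModel m) (bundleCoord he) u v) :
        CModel n × CModel m) = v := by
  have hP := (contMDiffAt_bundleParam hφ he (p := bundleCoord he u)
    (φ.map_source hu)).mdifferentiableAt (by simp)
  have hQ := (contMDiffAt_bundleCoord hφ he hu).mdifferentiableAt (by simp)
  have h : (bundleParam φ e ∘ bundleCoord he) =ᶠ[𝓝 u] id := by
    filter_upwards [(contMDiffAt_proj E (IB := 𝓘(ℂ, CModel n)) (n := ω)
      (p := u)).continuousAt.eventually (φ.open_source.eventually_mem hu)] with w hw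
    exact bundleParam_bundleCoord he hw
  have h2 : (mfderiv (totalModelC n m) (totalModelC n m) (bundleParam φ e ∘ bundleCoord he) u v :
      CModel n × CModel m) = v := by
    rw [h.mfderiv_eq, mfderiv_id]; rfl
  rw [mfderiv_comp u hP hQ] at h2
  exact h2

theorem mfderiv_bundleCoord_mfderiv_bundleParam
    (hφ : φ ∈ IsManifold.maximalAtlas 𝓘(ℂ, CModel n) ω M)
    (he : IsLocalFrameOn 𝓘(ℂ, CModel n) (CModel m) ω e φ.source)
    {u : TotalSpace (CModel m) E} (hu : u.proj ∈ φ.source) (v : CModel n × CModel m) :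
    (mfderiv (totalModelC n m) 𝓘(ℂ, CModel n × CModel m) (bundleCoord he) u
      (mfderiv 𝓘(ℂ, CModel n × CModel m) (totalModelC n m) (bundleParam φ e) (bundleCoord he u) v) :
        CModel n × CModel m) = v := by
  have hP := (contMDiffAt_bundleParam hφ he (p := bundleCoord he u)
    (φ.map_source hu)).mdifferentiableAt (by simp)
  have hQ := (contMDiffAt_bundleCoord hφ he hu).mdifferentiableAt (by simp)
  have h : (bundleCoord he ∘ bundleParam φ e) =ᶠ[𝓝 (bundleCoord he u)] id := by
    filter_upwards [continuous_fst.continuousAt.eventually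
      (φ.open_target.eventually_mem (φ.map_source hu))] with p hp
    exact bundleCoord_bundleParam he hp
  have h2 : (mfderiv 𝓘(ℂ, CModel n × CModel m) 𝓘(ℂ, CModel n × CModel m)
      (bundleCoord he ∘ bundleParam φ e) (bundleCoord he u) v : CModel n × CModel m) = v := by
    rw [h.mfderiv_eq, mfderiv_id]; rfl
  rw [mfderiv_comp_of_eq hQ hP (bundleParam_bundleCoord he hu)] at h2
  rw [bundleParam_bundleCoord he hu] at h2
  exact h2

/-- The derivative of the parametrization `bundleParam`, as an isomorphism onto the tangent space
at a point over the domain of the chart. -/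
noncomputable def bundleParamDeriv (hφ : φ ∈ IsManifold.maximalAtlas 𝓘(ℂ, CModel n) ω M)
    (he : IsLocalFrameOn 𝓘(ℂ, CModel n) (CModel m) ω e φ.source)
    {u : TotalSpace (CModel m) E} (hu : u.proj ∈ φ.source) :
    (CModel n × CModel m) ≃L[ℂ] TangentSpace (totalModelC n m) u :=
  ContinuousLinearEquiv.equivOfInverse
    (mfderiv 𝓘(ℂ, CModel n × CModel m) (totalModelC n m) (bundleParam φ e) (bundleCoord he u) :
      (CModel n × CModel m) →L[ℂ] (CModel n × CModel m))
    (mfderiv (totalModelC n m) 𝓘(ℂ, CModel n × CModel m) (bundleCoord he) u :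
      (CModel n × CModel m) →L[ℂ] (CModel n × CModel m))
    (mfderiv_bundleCoord_mfderiv_bundleParam hφ he hu)
    (mfderiv_bundleParam_mfderiv_bundleCoord hφ he hu)

/-- The vector field on `E` with coordinate expression `x` in the coordinates `(z^k, u^α)`. -/
noncomputable def coordField (he : IsLocalFrameOn 𝓘(ℂ, CModel n) (CModel m) ω e φ.source)
    (x : CModel n × CModel m → CModel n × CModel m) (u : TotalSpace (CModel m) E) :
    TangentSpace (totalModelC n m) u :=
  mfderiv 𝓘(ℂ, CModel n × CModel m) (totalModelC n m) (bundleParam φ e) (bundleCoord he u)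
    (x (bundleCoord he u))

theorem coordField_apply (hφ : φ ∈ IsManifold.maximalAtlas 𝓘(ℂ, CModel n) ω M)
    (he : IsLocalFrameOn 𝓘(ℂ, CModel n) (CModel m) ω e φ.source)
    {u : TotalSpace (CModel m) E} (hu : u.proj ∈ φ.source)
    (x : CModel n × CModel m → CModel n × CModel m) :
    coordField he x u = bundleParamDeriv hφ he hu (x (bundleCoord he u)) := rfl

/-- The pullback is defined by the inverse of the real derivative of the coordinate map; that
inverse is the derivative of the parametrization with scalars restricted to `ℝ`. -/
theorem mpullback_bundleCoord (hφ : φ ∈ IsManifold.maximalAtlas 𝓘(ℂ, CModel n) ω M)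
    (he : IsLocalFrameOn 𝓘(ℂ, CModel n) (CModel m) ω e φ.source)
    {u : TotalSpace (CModel m) E} (hu : u.proj ∈ φ.source)
    (x : CModel n × CModel m → CModel n × CModel m) :
    (VectorField.mpullback (totalModelR n m) 𝓘(ℝ, CModel n × CModel m) (bundleCoord he) x u :
      CModel n × CModel m) = coordField he x u := by
  have hQ := ((contMDiffAt_bundleCoord hφ he hu).mdifferentiableAt (by simp)).hasMFDerivAt
  let D : (CModel n × CModel m) ≃L[ℂ] (CModel n × CModel m) := bundleParamDeriv hφ he hu
  have hQ' : (mfderiv (totalModelR n m) 𝓘(ℝ, CModel n × CModel m) (bundleCoord he) u :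
      (CModel n × CModel m) →L[ℝ] (CModel n × CModel m))
      = (D.symm : (CModel n × CModel m) →L[ℂ] (CModel n × CModel m)).restrictScalars ℝ :=
    (HasMFDerivAt.restrictScalars_real (J := totalModelR n m)
      (J' := 𝓘(ℝ, CModel n × CModel m)) rfl rfl hQ).mfderiv
  have hinv : ContinuousLinearMap.inverse
      (mfderiv (totalModelR n m) 𝓘(ℝ, CModel n × CModel m) (bundleCoord he) u :
        (CModel n × CModel m) →L[ℝ] (CModel n × CModel m))
      = (D : (CModel n × CModel m) →L[ℂ] (CModel n × CModel m)).restrictScalars ℝ := by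
    rw [hQ']
    refine ContinuousLinearMap.inverse_eq ?_ ?_
    · ext1 v; exact D.symm_apply_apply v
    · ext1 v; exact D.apply_symm_apply v
  exact congrArg (fun f : (CModel n × CModel m) →L[ℝ] (CModel n × CModel m) =>
    f (x (bundleCoord he u))) hinv

/-- Lie brackets commute with pullback along the coordinate map. In the model space the real
derivatives of the analytic expressions `x` and `y` are their complex derivatives, so the usual
commutator formula may be written over `ℂ`. -/
theorem mlieBracket_coordField (hφ : φ ∈ IsManifold.maximalAtlas 𝓘(ℂ, CModel n) ω M)
    (he : IsLocalFrameOn 𝓘(ℂ, CModel n) (CModel m) ω e φ.source)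
    {u : TotalSpace (CModel m) E} (hu : u.proj ∈ φ.source)
    {x y : CModel n × CModel m → CModel n × CModel m}
    (hx : ContDiffAt ℂ ω x (bundleCoord he u)) (hy : ContDiffAt ℂ ω y (bundleCoord he u))
    {X Y : ∀ u : TotalSpace (CModel m) E, TangentSpace (totalModelC n m) u}
    (hX : X =ᶠ[𝓝 u] coordField he x) (hY : Y =ᶠ[𝓝 u] coordField he y) :
    (VectorField.mlieBracket (totalModelR n m) X Y u : CModel n × CModel m)
      = bundleParamDeriv hφ he hu (fderiv ℂ y (bundleCoord he u) (x (bundleCoord he u))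
          - fderiv ℂ x (bundleCoord he u) (y (bundleCoord he u))) := by
  have hsrc : ∀ᶠ w in 𝓝 u, w.proj ∈ φ.source :=
    (contMDiffAt_proj E (IB := 𝓘(ℂ, CModel n)) (n := ω)
      (p := u)).continuousAt.eventually (φ.open_source.eventually_mem hu)
  have hX' : X =ᶠ[𝓝 u]
      VectorField.mpullback (totalModelR n m) 𝓘(ℝ, CModel n × CModel m) (bundleCoord he) x := by
    filter_upwards [hX, hsrc] with w hw hws
    exact hw.trans (mpullback_bundleCoord hφ he hws x).symm
  have hY' : Y =ᶠ[𝓝 u]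
      VectorField.mpullback (totalModelR n m) 𝓘(ℝ, CModel n × CModel m) (bundleCoord he) y := by
    filter_upwards [hY, hsrc] with w hw hws
    exact hw.trans (mpullback_bundleCoord hφ he hws y).symm
  have hman := isManifold_totalModelR (n := n) m E
  have : IsManifold (totalModelR n m) (minSmoothness ℝ 3) (TotalSpace (CModel m) E) :=
    IsManifold.of_le (n := ω) le_top
  have hQ : ContMDiffAt (totalModelR n m) 𝓘(ℝ, CModel n × CModel m) ω (bundleCoord he) u :=
    ContMDiffAt.restrictScalars_real (I := totalModelC n m) (I' := 𝓘(ℂ, CModel n × CModel m))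
      rfl rfl (contMDiffAt_bundleCoord hφ he hu)
  have hsec : ∀ {z : CModel n × CModel m → CModel n × CModel m},
      ContDiffAt ℂ ω z (bundleCoord he u) →
      MDifferentiableAt 𝓘(ℝ, CModel n × CModel m) 𝓘(ℝ, CModel n × CModel m).tangent
        (fun p => (⟨p, z p⟩ : TangentBundle 𝓘(ℝ, CModel n × CModel m) (CModel n × CModel m)))
        (bundleCoord he u) := fun hz =>
    (contMDiffAt_vectorSpace_iff_contDiffAt.2 (hz.restrict_scalars ℝ)).mdifferentiableAt (by simp)
  have hx1 := hx.differentiableAt (by simp)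
  have hy1 := hy.differentiableAt (by simp)
  refine (Filter.EventuallyEq.mlieBracket_vectorField_eq (I := totalModelR n m) hX' hY').trans ?_
  have key := VectorField.mpullback_mlieBracket (hsec hx) (hsec hy) hQ le_top
  refine key.symm.trans ((mpullback_bundleCoord hφ he hu _).trans ?_)
  have hlie : (VectorField.mlieBracket 𝓘(ℝ, CModel n × CModel m) x y (bundleCoord he u) :
      CModel n × CModel m) = fderiv ℂ y (bundleCoord he u) (x (bundleCoord he u))
          - fderiv ℂ x (bundleCoord he u) (y (bundleCoord he u)) := by
    refine (congrFun VectorField.mlieBracket_eq_lieBracket _).trans ?_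
    simp only [VectorField.lieBracket, hx1.fderiv_restrictScalars ℝ, hy1.fderiv_restrictScalars ℝ]
    rfl
  exact congrArg (bundleParamDeriv hφ he hu) hlie

end CoordinateFields

/-! ### The bracket of a holomorphic Lie algebroid in local frames -/

section Sections

theorem IsHolAt.eventually {s : ∀ x, E x} {x : M} (hs : IsHolAt n m s x) :
    ∀ᶠ y in 𝓝 x, IsHolAt n m s y :=
  (contMDiffAt_iff_contMDiffAt_nhds (by simp)).1 hs

theorem IsHolAt.smul {f : M → ℂ} {s : ∀ x, E x} {x : M}
    (hf : ContMDiffAt 𝓘(ℂ, CModel n) 𝓘(ℂ) ω f x) (hs : IsHolAt n m s x) :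
    IsHolAt n m (fun y => f y • s y) x :=
  ContMDiffAt.smul_section hf hs

variable (n) in
theorem isHolAt_zero (x : M) : IsHolAt n m (0 : ∀ x, E x) x :=
  (contMDiff_zeroSection ℂ E).contMDiffAt

theorem IsHolAt.sum {ι : Type*} (S : Finset ι) {s : ι → ∀ x, E x} {x : M}
    (hs : ∀ i, IsHolAt n m (s i) x) : IsHolAt n m (fun y => ∑ i ∈ S, s i y) x :=
  ContMDiffAt.sum_section fun i _ => hs i

/-- The section with constant coordinates `a` in the distinguished trivialization around `b`. -/
noncomputable abbrev constSection (m : ℕ) (E : M → Type*)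
    [TopologicalSpace (TotalSpace (CModel m) E)] [∀ x, AddCommGroup (E x)] [∀ x, Module ℂ (E x)] [∀ x, TopologicalSpace (E x)]
    [FiberBundle (CModel m) E] (b : M) (a : CModel m) (x : M) : E x :=
  (trivializationAt (CModel m) E b).symm x a

variable (m) in
/-- The coordinates of the section `s` in the distinguished trivialization around `b`. -/
noncomputable abbrev sectionCoord (b : M) (s : ∀ x, E x) (x : M) : CModel m :=
  (trivializationAt (CModel m) E b ⟨x, s x⟩).2

variable (m E) in
theorem mem_baseSet_self (b : M) : b ∈ (trivializationAt (CModel m) E b).baseSet :=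
  mem_baseSet_trivializationAt (CModel m) E b

variable (m E) in
theorem eventually_mem_baseSet (b : M) :
    ∀ᶠ y in 𝓝 b, y ∈ (trivializationAt (CModel m) E b).baseSet :=
  (trivializationAt (CModel m) E b).open_baseSet.eventually_mem (mem_baseSet_self m E b)

theorem contMDiffAt_sectionCoord {s : ∀ x, E x} {b : M} (hs : IsHolAt n m s b) :
    ContMDiffAt 𝓘(ℂ, CModel n) 𝓘(ℂ, CModel m) ω (sectionCoord m b s) b :=
  contMDiffAt_trivialization_snd_section hs (mem_baseSet_self m E b)

theorem sectionCoord_constSection {b x : M}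
    (hx : x ∈ (trivializationAt (CModel m) E b).baseSet) (a : CModel m) :
    sectionCoord m b (constSection m E b a) x = a := by
  simp only [sectionCoord, (trivializationAt (CModel m) E b).apply_mk_symm hx]

theorem isHolAt_constSection (b : M) (a : CModel m) :
    IsHolAt n m (constSection m E b a) b := by
  refine ((trivializationAt (CModel m) E b).contMDiffAt_section_iff (IB := 𝓘(ℂ, CModel n))
    (n := ω) (mem_baseSet_self m E b)).2 ?_
  refine (contMDiffAt_const (c := a)).congr_of_eventuallyEq ?_
  filter_upwards [eventually_mem_baseSet m E b] with y hy
  exact sectionCoord_constSection hy a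

theorem constSection_sectionCoord {b x : M}
    (hx : x ∈ (trivializationAt (CModel m) E b).baseSet) (s : ∀ x, E x) :
    constSection m E b (sectionCoord m b s x) x = s x :=
  (trivializationAt (CModel m) E b).symm_apply_apply_mk hx (s x)

theorem trivialization_snd_eq {b x : M}
    (hx : x ∈ (trivializationAt (CModel m) E b).baseSet) (v : E x) :
    (trivializationAt (CModel m) E b ⟨x, v⟩).2
      = (trivializationAt (CModel m) E b).linearMapAt ℂ x v :=
  (congrFun ((trivializationAt (CModel m) E b).coe_linearMapAt_of_mem (R := ℂ) hx) v).symm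

theorem constSection_eq_symmₗ {b x : M}
    (hx : x ∈ (trivializationAt (CModel m) E b).baseSet) (a : CModel m) :
    constSection m E b a x = (trivializationAt (CModel m) E b).symmₗ ℂ x a := by
  rw [Trivialization.coe_symmₗ _ hx]

theorem constSection_eq_sum {b x : M}
    (hx : x ∈ (trivializationAt (CModel m) E b).baseSet) (a : CModel m) :
    constSection m E b a x = ∑ γ, a γ • constSection m E b (Pi.single γ 1) x := by
  simp only [constSection_eq_symmₗ hx, ← map_smul, ← map_sum]
  congr 1
  ext i
  simp [Finset.sum_apply, Pi.single_apply]

theorem eventually_eq_sum_constSection (s : ∀ x, E x) (b : M) :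
    ∀ᶠ y in 𝓝 b, s y = ∑ γ, sectionCoord m b s y γ • constSection m E b (Pi.single γ 1) y := by
  filter_upwards [eventually_mem_baseSet m E b] with y hy
  rw [← constSection_eq_sum hy, constSection_sectionCoord hy]

/-- The derivative of a vector valued function on `M`, with values in the fixed model space. -/
noncomputable def vecDeriv (f : M → CModel m) (x : M) :
    TangentSpace 𝓘(ℂ, CModel n) x →ₗ[ℂ] CModel m :=
  (mfderiv 𝓘(ℂ, CModel n) 𝓘(ℂ, CModel m) f x).toLinearMap

theorem holDeriv_apply {f : M → CModel m} {x : M}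
    (hf : MDifferentiableAt 𝓘(ℂ, CModel n) 𝓘(ℂ, CModel m) f x) (γ : Fin m)
    (v : TangentSpace 𝓘(ℂ, CModel n) x) :
    holDeriv (fun y => f y γ) x v
      = vecDeriv f x v γ := by
  have h := HasMFDerivAt.comp x
    (((ContinuousLinearMap.proj (R := ℂ) (φ := fun _ : Fin m => ℂ) γ).hasFDerivAt
      (x := f x)).hasMFDerivAt) hf.hasMFDerivAt
  exact DFunLike.congr_fun h.mfderiv v

end Sections

namespace HolLieAlgebroid

variable (L : HolLieAlgebroid n m M E) {s t r : ∀ x, E x} {x : M}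

theorem bracket_zero_right (hs : IsHolAt n m s x) : L.bracket s 0 x = 0 := by
  have := L.bracket_smul 0 s 0 x hs (isHolAt_zero n x)
  simpa using this

theorem bracket_zero_left (hs : IsHolAt n m s x) : L.bracket 0 s x = 0 := by
  rw [L.bracket_skew _ _ _ (isHolAt_zero n x) hs, L.bracket_zero_right hs, neg_zero]

theorem bracket_sum {ι : Type*} (S : Finset ι) {t : ι → ∀ x, E x} (hs : IsHolAt n m s x)
    (ht : ∀ i, IsHolAt n m (t i) x) :
    L.bracket s (fun y => ∑ i ∈ S, t i y) x = ∑ i ∈ S, L.bracket s (t i) x := by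
  classical
  induction S using Finset.induction_on with
  | empty => exact L.bracket_zero_right hs
  | insert i S hi ih =>
    rw [Finset.sum_insert hi, ← ih, ← L.bracket_add _ _ _ _ hs (ht i) (IsHolAt.sum S ht)]
    congr 1
    funext y
    simp [Finset.sum_insert hi]

theorem bracket_sum_smul {ι : Type*} (S : Finset ι) {f : ι → M → ℂ} {t : ι → ∀ x, E x}
    (hs : IsHolAt n m s x) (hf : ∀ i, ContMDiffAt 𝓘(ℂ, CModel n) 𝓘(ℂ) ω (f i) x)
    (ht : ∀ i, IsHolAt n m (t i) x) :
    L.bracket s (fun y => ∑ i ∈ S, f i y • t i y) x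
      = ∑ i ∈ S, (f i x • L.bracket s (t i) x + holDeriv (f i) x (L.anchor x (s x)) • t i x) := by
  rw [L.bracket_sum S hs fun i => (ht i).smul (hf i)]
  exact Finset.sum_congr rfl fun i _ => L.leibniz _ _ _ _ (hf i) hs (ht i)

/-- The bracket in terms of the coordinates with respect to the frame of constant sections. -/
theorem bracket_eq_expansion {b : M} (hs : IsHolAt n m s b) (ht : IsHolAt n m t b) :
    L.bracket s t b = constSection m E b
        (vecDeriv (sectionCoord m b t) b (L.anchor b (s b))) b
      - constSection m E b
        (vecDeriv (sectionCoord m b s) b (L.anchor b (t b))) b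
      + ∑ δ, ∑ γ, (sectionCoord m b s b δ * sectionCoord m b t b γ) •
        L.bracket (constSection m E b (Pi.single δ 1)) (constSection m E b (Pi.single γ 1)) b := by
  have hcoord : ∀ {r : ∀ x, E x}, IsHolAt n m r b → ∀ γ,
      ContMDiffAt 𝓘(ℂ, CModel n) 𝓘(ℂ) ω (fun y => sectionCoord m b r y γ) b :=
    fun hr γ => contMDiffAt_pi_space.1 (contMDiffAt_sectionCoord hr) γ
  have hexp : ∀ {r r' : ∀ x, E x}, IsHolAt n m r b → IsHolAt n m r' b →
      L.bracket r r' b = ∑ γ, (sectionCoord m b r' b γ •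
          L.bracket r (constSection m E b (Pi.single γ 1)) b
        + (vecDeriv (sectionCoord m b r') b (L.anchor b (r b))) γ •
            constSection m E b (Pi.single γ 1) b) := by
    intro r r' hr hr'
    rw [L.bracket_congr r r r' _ b hr hr' (Eventually.of_forall fun _ => rfl)
      (eventually_eq_sum_constSection (m := m) r' b), L.bracket_sum_smul Finset.univ hr (hcoord hr')
      (fun γ => isHolAt_constSection (E := E) b (Pi.single γ 1 : CModel m))]
    refine Finset.sum_congr rfl fun γ _ => ?_
    rw [holDeriv_apply ((contMDiffAt_sectionCoord hr').mdifferentiableAt (by simp))]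
  -- The Leibniz rule is available only in the second argument, so the first is expanded after a
  -- skew flip; this produces the minus sign of the second derivative term.
  have hflip : ∀ γ, L.bracket s (constSection m E b (Pi.single γ 1)) b
      = ∑ δ, sectionCoord m b s b δ •
          L.bracket (constSection m E b (Pi.single δ 1)) (constSection m E b (Pi.single γ 1)) b
        - constSection m E b (vecDeriv (sectionCoord m b s) b
            (L.anchor b (constSection m E b (Pi.single γ 1) b))) b := by
    intro γ
    have hγ := isHolAt_constSection (n := n) (E := E) b (Pi.single γ 1 : CModel m)
    rw [L.bracket_skew _ _ _ hs hγ, hexp hγ hs, Finset.sum_add_distrib,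
      ← constSection_eq_sum (mem_baseSet_self m E b), neg_add, ← sub_eq_add_neg, ← Finset.sum_neg_distrib]
    congr 1
    refine Finset.sum_congr rfl fun δ _ => ?_
    rw [L.bracket_skew _ _ _ hγ (isHolAt_constSection b _), smul_neg, neg_neg]
  have htb := (eventually_eq_sum_constSection (m := m) t b).self_of_nhds
  have hlin := constSection_eq_symmₗ (mem_baseSet_self m E b)
  rw [hexp hs ht, Finset.sum_add_distrib, ← constSection_eq_sum (mem_baseSet_self m E b)]
  simp only [hflip, smul_sub, Finset.sum_sub_distrib, Finset.smul_sum, smul_smul]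
  have h1 : constSection m E b
        (vecDeriv (sectionCoord m b s) b (L.anchor b (t b))) b
      = ∑ γ, sectionCoord m b t b γ • constSection m E b
        (vecDeriv (sectionCoord m b s) b (L.anchor b (constSection m E b (Pi.single γ 1) b))) b := by
    conv_lhs => rw [htb]
    simp only [hlin, map_sum, map_smul]
  rw [h1, Finset.sum_comm]
  simp only [mul_comm (sectionCoord m b t b _)]
  abel

/-- Sections with constant coordinates lose both derivative terms of `bracket_eq_expansion`; what
remains is bilinear over `ℂ` in the coordinates. -/
theorem constBracket_eq_sum (b : M) (a a' : CModel m) :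
    L.constBracket b a a' = ∑ δ, ∑ γ, (a δ * a' γ) •
      L.constBracket b (Pi.single δ 1) (Pi.single γ 1) := by
  have hconst : ∀ a (v : TangentSpace 𝓘(ℂ, CModel n) b),
      vecDeriv (sectionCoord m b (constSection m E b a)) b v = 0 := by
    intro a v
    have : sectionCoord m b (constSection m E b a) =ᶠ[𝓝 b] fun _ => a := by
      filter_upwards [eventually_mem_baseSet m E b] with y hy
      exact sectionCoord_constSection hy a
    rw [vecDeriv, this.mfderiv_eq, mfderiv_const]
    rfl
  have h := L.bracket_eq_expansion (isHolAt_constSection (n := n) (E := E) b a)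
    (isHolAt_constSection b a')
  rw [hconst, hconst, sectionCoord_constSection (mem_baseSet_self m E b),
    sectionCoord_constSection (mem_baseSet_self m E b), sub_self, zero_add] at h
  simp only [constBracket, trivialization_snd_eq (mem_baseSet_self m E b)]
  rw [h]
  simp only [map_sum, map_smul]

theorem constBracket_smul_smul (b : M) (c d : ℂ) (a a' : CModel m) :
    L.constBracket b (c • a) (d • a') = (c * d) • L.constBracket b a a' := by
  rw [L.constBracket_eq_sum b a a', L.constBracket_eq_sum b (c • a)]
  simp only [Finset.smul_sum, smul_smul, Pi.smul_apply, smul_eq_mul]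
  refine Finset.sum_congr rfl fun δ _ => Finset.sum_congr rfl fun γ _ => ?_
  congr 1
  ring

/-- The right-hand side has the shape of the first component of `realBracket`, with derivatives
taken on `M` along the anchors instead of on `E`. -/
theorem bracket_eq_constBracket {b : M} (hs : IsHolAt n m s b) (ht : IsHolAt n m t b) :
    L.bracket s t b = constSection m E b
      ((vecDeriv (sectionCoord m b t) b (L.anchor b (s b)))
        - (vecDeriv (sectionCoord m b s) b (L.anchor b (t b)))
        + L.constBracket b (sectionCoord m b s b) (sectionCoord m b t b)) b := by
  have hlin := constSection_eq_symmₗ (mem_baseSet_self m E b)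
  rw [L.bracket_eq_expansion hs ht, L.constBracket_eq_sum, hlin, hlin, hlin, map_add, map_sub]
  congr 1
  rw [map_sum]
  refine Finset.sum_congr rfl fun δ _ => ?_
  rw [map_sum]
  refine Finset.sum_congr rfl fun γ _ => ?_
  rw [map_smul, ← hlin]
  congr 1
  exact ((trivializationAt (CModel m) E b).symm_apply_apply_mk (mem_baseSet_self m E b) _).symm

/-- The anchor of a holomorphic Lie algebroid is compatible with the brackets: the derivative along
`ρ([s, t])` is the commutator of the derivatives along `ρ(s)` and `ρ(t)`. -/
theorem holDeriv_anchor_bracket {f : M → ℂ} (hs : IsHolAt n m s x) (ht : IsHolAt n m t x)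
    (hr : IsHolAt n m r x) (hr0 : r x ≠ 0) (hf : ContMDiffAt 𝓘(ℂ, CModel n) 𝓘(ℂ) ω f x)
    (hfs : ContMDiffAt 𝓘(ℂ, CModel n) 𝓘(ℂ) ω (fun y => holDeriv f y (L.anchor y (s y))) x)
    (hft : ContMDiffAt 𝓘(ℂ, CModel n) 𝓘(ℂ) ω (fun y => holDeriv f y (L.anchor y (t y))) x) :
    holDeriv f x (L.anchor x (L.bracket s t x))
      = holDeriv (fun y => holDeriv f y (L.anchor y (t y))) x (L.anchor x (s x))
        - holDeriv (fun y => holDeriv f y (L.anchor y (s y))) x (L.anchor x (t x)) := by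
  have hfr := hr.smul hf
  have hfe : ∀ᶠ y in 𝓝 x, ContMDiffAt 𝓘(ℂ, CModel n) 𝓘(ℂ) ω f y :=
    (contMDiffAt_iff_contMDiffAt_nhds (by simp)).1 hf
  have hself : ∀ q : ∀ x, E x, ∀ᶠ y in 𝓝 x, q y = q y := fun q => Eventually.of_forall fun _ => rfl
  -- Leibniz applied twice to `[p, [q, f r]]`. The inner application must hold on a neighbourhood,
  -- because the outer bracket depends on the germ of its argument.
  have step : ∀ {p q : ∀ x, E x}, IsHolAt n m p x → IsHolAt n m q x →
      ContMDiffAt 𝓘(ℂ, CModel n) 𝓘(ℂ) ω (fun y => holDeriv f y (L.anchor y (q y))) x →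
      L.bracket p (L.bracket q (fun y => f y • r y)) x
        = f x • L.bracket p (L.bracket q r) x + holDeriv f x (L.anchor x (p x)) • L.bracket q r x
          + (holDeriv f x (L.anchor x (q x)) • L.bracket p r x
            + holDeriv (fun y => holDeriv f y (L.anchor y (q y))) x (L.anchor x (p x)) • r x) := by
    intro p q hp hq hfq
    have hqr := L.bracket_hol _ _ _ hq hr
    have hev : ∀ᶠ y in 𝓝 x, L.bracket q (fun y => f y • r y) y
        = ((fun y => f y • L.bracket q r y)
          + fun y => holDeriv f y (L.anchor y (q y)) • r y : ∀ x, E x) y := by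
      filter_upwards [hfe, hq.eventually, hr.eventually] with y hfy hqy hry
      exact L.leibniz f q r y hfy hqy hry
    rw [L.bracket_congr p p _ _ x hp (L.bracket_hol _ _ _ hq hfr) (hself p) hev,
      L.bracket_add _ _ _ _ hp (hqr.smul hf) (hr.smul hfq), L.leibniz _ _ _ _ hf hp hqr,
      L.leibniz _ _ _ _ hfq hp hr]
  have hneg : ∀ {p q q' : ∀ x, E x}, IsHolAt n m p x → IsHolAt n m q x → IsHolAt n m q' x →
      L.bracket p (L.bracket q q') x = -L.bracket p (L.bracket q' q) x := by
    intro p q q' hp hq hq'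
    have hev : ∀ᶠ y in 𝓝 x, L.bracket q q' y = ((-1 : ℂ) • L.bracket q' q) y := by
      filter_upwards [hq.eventually, hq'.eventually] with y hqy hqy'
      simp [L.bracket_skew _ _ _ hqy hqy']
    rw [L.bracket_congr p p _ _ x hp (L.bracket_hol _ _ _ hq hq') (hself p) hev,
      L.bracket_smul _ _ _ _ hp (L.bracket_hol _ _ _ hq' hq), neg_one_smul]
  have hst := L.bracket_hol _ _ _ hs ht
  have j1 := L.jacobi s t (fun y => f y • r y) x hs ht hfr
  have j2 := L.jacobi s t r x hs ht hr
  rw [step hs ht hft, hneg ht hfr hs, step ht hs hfs,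
    L.bracket_skew _ _ _ hfr hst, L.leibniz _ _ _ _ hf hst hr] at j1
  rw [hneg ht hr hs, L.bracket_skew _ _ _ hr hst] at j2
  -- Subtracting `f` times the Jacobi identity for `s, t, r` from the one for `s, t, f r` removes
  -- the double brackets; the terms with one derivative of `f` times `[s, r]` or `[t, r]` cancel in
  -- pairs. Only multiples of `r x` are left, and `r x ≠ 0`.
  have key : (holDeriv (fun y => holDeriv f y (L.anchor y (t y))) x (L.anchor x (s x))
      - holDeriv (fun y => holDeriv f y (L.anchor y (s y))) x (L.anchor x (t x))
      - holDeriv f x (L.anchor x (L.bracket s t x))) • r x = 0 := by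
    linear_combination (norm := module) j1 - f x • j2
  have := (smul_eq_zero.1 key).resolve_right hr0
  exact (sub_eq_zero.1 this).symm

end HolLieAlgebroid

/-! ### Real brackets of holomorphic sections of the prolongation -/

section HolomorphicPairs

variable {φ : OpenPartialHomeomorph M (CModel n)} {e : Fin m → ∀ x, E x}

/-- The pair `(s, X)` of a section of `π^*E` and a vector field on `E` is holomorphic near `u`. -/
structure IsHolPair (he : IsLocalFrameOn 𝓘(ℂ, CModel n) (CModel m) ω e φ.source)
    (s : ∀ u : TotalSpace (CModel m) E, E u.proj)
    (X : ∀ u : TotalSpace (CModel m) E, TangentSpace (totalModelC n m) u)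
    (u : TotalSpace (CModel m) E) : Prop where
  fibre : MDifferentiableAt (totalModelC n m) 𝓘(ℂ, CModel m) (fibreCoord u.proj s) u
  field : ∃ x, ContDiffAt ℂ ω x (bundleCoord he u) ∧ X =ᶠ[𝓝 u] coordField he x

theorem realDeriv_eq {g : TotalSpace (CModel m) E → CModel m} {u : TotalSpace (CModel m) E}
    (hg : MDifferentiableAt (totalModelC n m) 𝓘(ℂ, CModel m) g u)
    (v : TangentSpace (totalModelC n m) u) :
    realDeriv g u v = mfderiv (totalModelC n m) 𝓘(ℂ, CModel m) g u v :=
  DFunLike.congr_fun (HasMFDerivAt.restrictScalars_real (J := totalModelR n m)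
    (J' := 𝓘(ℝ, CModel m)) rfl rfl hg.hasMFDerivAt).mfderiv v

theorem realDeriv_smul {g : TotalSpace (CModel m) E → CModel m} {u : TotalSpace (CModel m) E}
    (hg : MDifferentiableAt (totalModelC n m) 𝓘(ℂ, CModel m) g u) (c : ℂ)
    (v : TangentSpace (totalModelC n m) u) :
    realDeriv g u (c • v) = c • realDeriv g u v := by
  rw [realDeriv_eq hg, realDeriv_eq hg]
  exact (mfderiv (totalModelC n m) 𝓘(ℂ, CModel m) g u).map_smul c v

theorem realDeriv_congr {g g' : TotalSpace (CModel m) E → CModel m} {u : TotalSpace (CModel m) E}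
    (h : g =ᶠ[𝓝 u] g') (v : TangentSpace (totalModelC n m) u) :
    realDeriv g u v = realDeriv g' u v := by
  simp only [realDeriv]
  exact DFunLike.congr_fun (h.mfderiv_eq (I := totalModelR n m) (I' := 𝓘(ℝ, CModel m))) v

theorem realDeriv_const_smul {g : TotalSpace (CModel m) E → CModel m}
    {u : TotalSpace (CModel m) E}
    (hg : MDifferentiableAt (totalModelC n m) 𝓘(ℂ, CModel m) g u) (c : ℂ)
    (v : TangentSpace (totalModelC n m) u) :
    realDeriv (c • g) u v = c • realDeriv g u v := by
  have h := hg.hasMFDerivAt.const_smul c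
  rw [realDeriv_eq hg, realDeriv_eq h.mdifferentiableAt, h.mfderiv]
  rfl

theorem eventually_proj {p : M → Prop} {u : TotalSpace (CModel m) E}
    (h : ∀ᶠ y in 𝓝 u.proj, p y) : ∀ᶠ w in 𝓝 u, p w.proj :=
  (FiberBundle.continuous_proj (CModel m) E).continuousAt.eventually h

theorem fibreCoord_const_smul {b : M} {u : TotalSpace (CModel m) E}
    (hu : u.proj ∈ (trivializationAt (CModel m) E b).baseSet) (c : ℂ)
    (s : ∀ u : TotalSpace (CModel m) E, E u.proj) :
    fibreCoord b (fun u => c • s u) u = c • fibreCoord b s u := by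
  simp only [fibreCoord, trivialization_snd_eq hu, map_smul]

theorem fibreCoord_const_smul_eventuallyEq (u : TotalSpace (CModel m) E) (c : ℂ)
    (s : ∀ u : TotalSpace (CModel m) E, E u.proj) :
    fibreCoord u.proj (fun u => c • s u) =ᶠ[𝓝 u] c • fibreCoord u.proj s := by
  filter_upwards [eventually_proj (eventually_mem_baseSet m E u.proj)] with w hw
  exact fibreCoord_const_smul hw c s

theorem coordField_const_smul (he : IsLocalFrameOn 𝓘(ℂ, CModel n) (CModel m) ω e φ.source) (c : ℂ)
    (x : CModel n × CModel m → CModel n × CModel m) (u : TotalSpace (CModel m) E) :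
    coordField he (c • x) u = c • coordField he x u :=
  map_smul (mfderiv 𝓘(ℂ, CModel n × CModel m) (totalModelC n m) (bundleParam φ e)
    (bundleCoord he u)) c (x (bundleCoord he u))

/-- The real bracket is only real bilinear in general. For holomorphic pairs each term is a complex
linear derivative of one argument in the direction of the other, or the bilinear `constBracket`, so
both scalars come out. -/
theorem HolLieAlgebroid.realBracket_smul_smul (L : HolLieAlgebroid n m M E)
    (hφ : φ ∈ IsManifold.maximalAtlas 𝓘(ℂ, CModel n) ω M)
    {he : IsLocalFrameOn 𝓘(ℂ, CModel n) (CModel m) ω e φ.source}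
    {u : TotalSpace (CModel m) E} (hu : u.proj ∈ φ.source)
    {s t : ∀ u : TotalSpace (CModel m) E, E u.proj}
    {X Y : ∀ u : TotalSpace (CModel m) E, TangentSpace (totalModelC n m) u}
    (hs : IsHolPair he s X u) (ht : IsHolPair he t Y u) (c d : ℂ) :
    L.realBracket (fun u => c • s u) (fun u => d • t u) (fun u => c • X u) (fun u => d • Y u) u
      = (c * d) • L.realBracket s t X Y u := by
  have hb := mem_baseSet_self m E u.proj
  refine Prod.ext ?_ ?_
  · simp only [HolLieAlgebroid.realBracket, Prod.smul_fst]
    rw [← Trivialization.coe_symmₗ (R := ℂ) _ hb, ← map_smul,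
      realDeriv_congr (fibreCoord_const_smul_eventuallyEq u d t),
      realDeriv_congr (fibreCoord_const_smul_eventuallyEq u c s),
      realDeriv_const_smul ht.fibre, realDeriv_const_smul hs.fibre, realDeriv_smul ht.fibre,
      realDeriv_smul hs.fibre, fibreCoord_const_smul hb, fibreCoord_const_smul hb,
      L.constBracket_smul_smul]
    congr 1
    module
  · obtain ⟨x, hx, hX⟩ := hs.field
    obtain ⟨y, hy, hY⟩ := ht.field
    have hX' : (fun u => c • X u) =ᶠ[𝓝 u] coordField he (c • x) := by
      filter_upwards [hX] with w hw
      rw [coordField_const_smul, hw]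
    have hY' : (fun u => d • Y u) =ᶠ[𝓝 u] coordField he (d • y) := by
      filter_upwards [hY] with w hw
      rw [coordField_const_smul, hw]
    have h1 := mlieBracket_coordField hφ he hu hx hy hX hY
    have h2 := mlieBracket_coordField hφ he hu (x := c • x) (y := d • y)
      (hx.const_smul c) (hy.const_smul d) hX' hY'
    refine h2.trans ((?_ : _ = (c * d) • _).trans (congrArg (fun v : CModel n × CModel m =>
      (c * d) • v) h1).symm)
    refine (congrArg (bundleParamDeriv hφ he hu) ?_).trans (map_smul (bundleParamDeriv hφ he hu) _ _)
    rw [fderiv_const_smul (hx.differentiableAt (by simp)),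
      fderiv_const_smul (hy.differentiableAt (by simp))]
    simp only [_root_.smul_apply, Pi.smul_apply, map_smul]
    module

end HolomorphicPairs

/-! ### Complex brackets of holomorphic and antiholomorphic sections -/

section ComplexBracket

variable {φ : OpenPartialHomeomorph M (CModel n)} {e : Fin m → ∀ x, E x}

/-- The section `((a + i b) s, (a + i b) X)` of the complexified prolongation, where the products
`a s`, `b s`, `a X`, `b X` are formed in the complex vector spaces `E_π(u)` and `T_u E`. -/
noncomputable def scaledPair (a b : ℂ) (s : ∀ u : TotalSpace (CModel m) E, E u.proj)
    (X : ∀ u : TotalSpace (CModel m) E, TangentSpace (totalModelC n m) u)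
    (u : TotalSpace (CModel m) E) : AmbientFibre n m E u :=
  (Cplx.ofScalars a b (s u), Cplx.ofScalars a b (X u))

/-- All four real brackets in the definition are complex multiples of a single one, and their
coefficients combine like the product `(a + i b)(c + i d)`, with the outer `i` kept apart from the
scalars `a, b, c, d`. -/
theorem HolLieAlgebroid.prolongBracket_scaledPair (L : HolLieAlgebroid n m M E)
    (hφ : φ ∈ IsManifold.maximalAtlas 𝓘(ℂ, CModel n) ω M)
    {he : IsLocalFrameOn 𝓘(ℂ, CModel n) (CModel m) ω e φ.source}
    {u : TotalSpace (CModel m) E} (hu : u.proj ∈ φ.source)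
    {s t : ∀ u : TotalSpace (CModel m) E, E u.proj}
    {X Y : ∀ u : TotalSpace (CModel m) E, TangentSpace (totalModelC n m) u}
    (hs : IsHolPair he s X u) (ht : IsHolPair he t Y u) (a b c d : ℂ) :
    L.prolongBracket (scaledPair a b s X) (scaledPair c d t Y) u
      = (Cplx.ofScalars (a * c - b * d) (a * d + b * c) (L.realBracket s t X Y u).1,
          Cplx.ofScalars (a * c - b * d) (a * d + b * c) (L.realBracket s t X Y u).2) := by
  have h := fun c d => L.realBracket_smul_smul hφ hu hs ht c d
  simp only [HolLieAlgebroid.prolongBracket, scaledPair, Cplx.ofScalars, h, sub_smul, add_smul,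
    Prod.smul_fst, Prod.smul_snd]

/-- A pair `(s, X)` as a `(1,0)`-section of the complexified prolongation. -/
noncomputable def holSection (s : ∀ u : TotalSpace (CModel m) E, E u.proj)
    (X : ∀ u : TotalSpace (CModel m) E, TangentSpace (totalModelC n m) u)
    (u : TotalSpace (CModel m) E) : AmbientFibre n m E u :=
  (Cplx.hol (s u), Cplx.hol (X u))

theorem holSection_eq (s : ∀ u : TotalSpace (CModel m) E, E u.proj)
    (X : ∀ u : TotalSpace (CModel m) E, TangentSpace (totalModelC n m) u) :
    holSection s X = scaledPair (1 / 2) (-(Complex.I / 2)) s X :=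
  funext fun u => by simp only [holSection, scaledPair, Cplx.hol_eq_ofScalars]

theorem conjFibre_holSection_eq (s : ∀ u : TotalSpace (CModel m) E, E u.proj)
    (X : ∀ u : TotalSpace (CModel m) E, TangentSpace (totalModelC n m) u) :
    (fun u => conjFibre (holSection s X u)) = scaledPair (1 / 2) (Complex.I / 2) s X :=
  funext fun u => by
    simp only [holSection, conjFibre, scaledPair, Cplx.conj_hol_eq_ofScalars]

section

variable (L : HolLieAlgebroid n m M E) (hφ : φ ∈ IsManifold.maximalAtlas 𝓘(ℂ, CModel n) ω M)
  {he : IsLocalFrameOn 𝓘(ℂ, CModel n) (CModel m) ω e φ.source}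
  {u : TotalSpace (CModel m) E} (hu : u.proj ∈ φ.source)
  {s t : ∀ u : TotalSpace (CModel m) E, E u.proj}
  {X Y : ∀ u : TotalSpace (CModel m) E, TangentSpace (totalModelC n m) u}
  (hs : IsHolPair he s X u) (ht : IsHolPair he t Y u)

include hφ hu hs ht

/-- The coefficient pair `(1/2, -i/2)` represents the projector onto the (1,0) part, an idempotent
of `ℂ ⊗ ℂ`. -/
theorem HolLieAlgebroid.prolongBracket_hol_hol :
    L.prolongBracket (holSection s X) (holSection t Y) u
      = (Cplx.hol (L.realBracket s t X Y u).1, Cplx.hol (L.realBracket s t X Y u).2) := by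
  have h1 : (1 / 2 * (1 / 2) - -(Complex.I / 2) * -(Complex.I / 2) : ℂ) = 1 / 2 := by
    linear_combination (-(1 / 4) : ℂ) * Complex.I_mul_I
  have h2 : (1 / 2 * -(Complex.I / 2) + -(Complex.I / 2) * (1 / 2) : ℂ) = -(Complex.I / 2) := by
    ring
  rw [holSection_eq, holSection_eq, L.prolongBracket_scaledPair hφ hu hs ht, h1, h2,
    Cplx.hol_eq_ofScalars, Cplx.hol_eq_ofScalars]

theorem HolLieAlgebroid.prolongBracket_conj_conj :
    L.prolongBracket (fun u => conjFibre (holSection s X u)) (fun u => conjFibre (holSection t Y u)) u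
      = conjFibre (L.prolongBracket (holSection s X) (holSection t Y) u) := by
  have h1 : (1 / 2 * (1 / 2) - Complex.I / 2 * (Complex.I / 2) : ℂ) = 1 / 2 := by
    linear_combination (-(1 / 4) : ℂ) * Complex.I_mul_I
  have h2 : (1 / 2 * (Complex.I / 2) + Complex.I / 2 * (1 / 2) : ℂ) = Complex.I / 2 := by
    ring
  rw [L.prolongBracket_hol_hol hφ hu hs ht, conjFibre_holSection_eq, conjFibre_holSection_eq,
    L.prolongBracket_scaledPair hφ hu hs ht, h1, h2]
  simp only [conjFibre, Cplx.conj_hol_eq_ofScalars]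

/-- The projectors onto the (1,0) and (0,1) parts are orthogonal idempotents, so their product
vanishes whatever the real bracket is. -/
theorem HolLieAlgebroid.prolongBracket_hol_conj :
    L.prolongBracket (holSection s X) (fun u => conjFibre (holSection t Y u)) u = 0 := by
  have h1 : (1 / 2 * (1 / 2) - -(Complex.I / 2) * (Complex.I / 2) : ℂ) = 0 := by
    linear_combination (1 / 4 : ℂ) * Complex.I_mul_I
  have h2 : (1 / 2 * (Complex.I / 2) + -(Complex.I / 2) * (1 / 2) : ℂ) = 0 := by
    ring
  rw [conjFibre_holSection_eq, holSection_eq, L.prolongBracket_scaledPair hφ hu hs ht, h1, h2]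
  simp only [Cplx.ofScalars, zero_smul]
  rfl

theorem HolLieAlgebroid.prolongBracket_conj_hol :
    L.prolongBracket (fun u => conjFibre (holSection s X u)) (holSection t Y) u = 0 := by
  have h1 : (1 / 2 * (1 / 2) - Complex.I / 2 * -(Complex.I / 2) : ℂ) = 0 := by
    linear_combination (1 / 4 : ℂ) * Complex.I_mul_I
  have h2 : (1 / 2 * -(Complex.I / 2) + Complex.I / 2 * (1 / 2) : ℂ) = 0 := by
    ring
  rw [conjFibre_holSection_eq, holSection_eq, L.prolongBracket_scaledPair hφ hu hs ht, h1, h2]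
  simp only [Cplx.ofScalars, zero_smul]
  rfl

end

/-! ### The fibre component of the bracket of pulled back sections -/

theorem mdifferentiableAt_fibreCoord {σ : ∀ x, E x} {u : TotalSpace (CModel m) E}
    (hσ : IsHolAt n m σ u.proj) :
    MDifferentiableAt (totalModelC n m) 𝓘(ℂ, CModel m)
      (fibreCoord u.proj fun w => σ w.proj) u :=
  ((contMDiffAt_sectionCoord hσ).comp u (contMDiffAt_proj E)).mdifferentiableAt (by simp)

theorem realDeriv_fibreCoord {σ : ∀ x, E x} {u : TotalSpace (CModel m) E}
    (hσ : IsHolAt n m σ u.proj) (v : TangentSpace (totalModelC n m) u) :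
    realDeriv (fibreCoord u.proj fun w => σ w.proj) u v
      = vecDeriv (sectionCoord m u.proj σ) u.proj (projDeriv n m E u v) := by
  rw [realDeriv_eq (mdifferentiableAt_fibreCoord hσ)]
  have h := mfderiv_comp u ((contMDiffAt_sectionCoord hσ).mdifferentiableAt (by simp))
    ((contMDiffAt_proj E (IB := 𝓘(ℂ, CModel n)) (n := ω) (p := u)).mdifferentiableAt (by simp))
  exact DFunLike.congr_fun h v

/-- The bracket of `(σ ∘ π, X)` and `(τ ∘ π, Y)` has first component `[σ, τ] ∘ π`. -/
theorem HolLieAlgebroid.realBracket_fst (L : HolLieAlgebroid n m M E) {σ τ : ∀ x, E x}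
    {u : TotalSpace (CModel m) E} (hσ : IsHolAt n m σ u.proj) (hτ : IsHolAt n m τ u.proj)
    {X Y : ∀ u : TotalSpace (CModel m) E, TangentSpace (totalModelC n m) u}
    (hX : projDeriv n m E u (X u) = L.anchor u.proj (σ u.proj))
    (hY : projDeriv n m E u (Y u) = L.anchor u.proj (τ u.proj)) :
    (L.realBracket (fun w => σ w.proj) (fun w => τ w.proj) X Y u).1 = L.bracket σ τ u.proj := by
  simp only [HolLieAlgebroid.realBracket]
  rw [realDeriv_fibreCoord hσ, realDeriv_fibreCoord hτ, hX, hY, L.bracket_eq_constBracket hσ hτ]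
  rfl

end ComplexBracket

/-! ### The anchor in coordinates -/

section AnchorCoordinates

variable {φ : OpenPartialHomeomorph M (CModel n)} {e : Fin m → ∀ x, E x}

theorem OpenPartialHomeomorph.mdifferentiable_of_mem_maximalAtlas
    (hφ : φ ∈ IsManifold.maximalAtlas 𝓘(ℂ, CModel n) ω M) :
    φ.MDifferentiable 𝓘(ℂ, CModel n) 𝓘(ℂ, CModel n) :=
  ⟨(contMDiffOn_of_mem_maximalAtlas hφ).mdifferentiableOn (by simp),
    (contMDiffOn_symm_of_mem_maximalAtlas hφ).mdifferentiableOn (by simp)⟩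

theorem vecDeriv_chart_injective (hφ : φ ∈ IsManifold.maximalAtlas 𝓘(ℂ, CModel n) ω M)
    {x : M} (hx : x ∈ φ.source) : Function.Injective (vecDeriv (n := n) (m := n) φ x) :=
  ((OpenPartialHomeomorph.mdifferentiable_of_mem_maximalAtlas hφ).mfderiv hx).injective

/-- In coordinates `π` is the first projection. Together with `vecDeriv_chart_injective` this
identifies the vertical vectors as those with zero `z`-part. -/
theorem vecDeriv_chart_projDeriv (hφ : φ ∈ IsManifold.maximalAtlas 𝓘(ℂ, CModel n) ω M)
    (he : IsLocalFrameOn 𝓘(ℂ, CModel n) (CModel m) ω e φ.source)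
    {u : TotalSpace (CModel m) E} (hu : u.proj ∈ φ.source) (v : CModel n × CModel m) :
    vecDeriv φ u.proj (projDeriv n m E u (bundleParamDeriv hφ he hu v)) = v.1 := by
  have hP := (contMDiffAt_bundleParam hφ he (p := bundleCoord he u)
    (φ.map_source hu)).mdifferentiableAt (by simp)
  have hpi : MDifferentiableAt (totalModelC n m) 𝓘(ℂ, CModel n)
      (fun w : TotalSpace (CModel m) E => w.proj) u :=
    (contMDiffAt_proj E (IB := 𝓘(ℂ, CModel n)) (n := ω) (p := u)).mdifferentiableAt (by simp)
  have hc : MDifferentiableAt 𝓘(ℂ, CModel n) 𝓘(ℂ, CModel n) φ u.proj :=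
    (contMDiffAt_of_mem_maximalAtlas hφ hu).mdifferentiableAt (by simp)
  have h : ((fun w : TotalSpace (CModel m) E => φ w.proj) ∘ bundleParam φ e)
      =ᶠ[𝓝 (bundleCoord he u)] Prod.fst := by
    filter_upwards [continuous_fst.continuousAt.eventually
      (φ.open_target.eventually_mem (φ.map_source hu))] with p hp
    exact φ.right_inv hp
  have h1 := mfderiv_comp u hc hpi
  have h2 := mfderiv_comp_of_eq (hc.comp u hpi) hP (bundleParam_bundleCoord he hu)
  have h3 := h.mfderiv_eq (I := 𝓘(ℂ, CModel n × CModel m)) (I' := 𝓘(ℂ, CModel n))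
  have h4 : mfderiv 𝓘(ℂ, CModel n × CModel m) 𝓘(ℂ, CModel n)
      (Prod.fst : CModel n × CModel m → CModel n) (bundleCoord he u)
      = ContinuousLinearMap.fst ℂ (CModel n) (CModel m) := by
    rw [mfderiv_eq_fderiv]; exact fderiv_fst
  have h5 := (h2.symm.trans h3).trans h4
  rw [bundleParam_bundleCoord he hu] at h5
  have h6 := DFunLike.congr_fun h5 v
  refine Eq.trans ?_ h6
  exact (DFunLike.congr_fun h1 _).symm

namespace HolLieAlgebroid

variable (L : HolLieAlgebroid n m M E)

variable (φ e) in
/-- The vector `(ρ^k_α)_k` of anchor coefficients of `e_α`. -/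
noncomputable def anchorVec (α : Fin m) (x : M) : CModel n := vecDeriv φ x (L.anchor x (e α x))

/-- The vector is the fibre component of the tangent map of the chart applied to the holomorphic
vector field `ρ(e_α)`. -/
theorem contMDiffAt_anchorVec (hφ : φ ∈ IsManifold.maximalAtlas 𝓘(ℂ, CModel n) ω M)
    (he : IsLocalFrameOn 𝓘(ℂ, CModel n) (CModel m) ω e φ.source) (α : Fin m)
    {x : M} (hx : x ∈ φ.source) :
    ContMDiffAt 𝓘(ℂ, CModel n) 𝓘(ℂ, CModel n) ω (L.anchorVec φ e α) x := by
  have h1 : ContMDiffAt 𝓘(ℂ, CModel n) 𝓘(ℂ, CModel n).tangent ω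
      (fun y => (⟨y, L.anchor y (e α y)⟩ : TangentBundle 𝓘(ℂ, CModel n) M)) x :=
    (L.anchor_hol.contMDiffAt).comp x (he.contMDiffAt φ.open_source hx α)
  have h2 := (contMDiffOn_of_mem_maximalAtlas hφ).contMDiffOn_tangentMapWithin (m := ω)
    le_top φ.open_source.uniqueMDiffOn
  have hmem : (TotalSpace.proj ⁻¹' φ.source : Set (TangentBundle 𝓘(ℂ, CModel n) M))
      ∈ 𝓝 (⟨x, L.anchor x (e α x)⟩ : TangentBundle 𝓘(ℂ, CModel n) M) :=
    (FiberBundle.continuous_proj (CModel n) (TangentSpace 𝓘(ℂ, CModel n) (M := M))).continuousAt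
      |>.preimage_mem_nhds (φ.open_source.mem_nhds hx)
  have h3 := (h2.contMDiffAt hmem).comp x h1
  have h4 := ((contMDiff_snd_tangentBundle_modelSpace (n := ω) (CModel n)
    𝓘(ℂ, CModel n)).contMDiffAt).comp x h3
  refine h4.congr_of_eventuallyEq ?_
  filter_upwards [φ.open_source.eventually_mem hx] with y hy
  simp only [anchorVec, vecDeriv, Function.comp, tangentMapWithin,
    mfderivWithin_of_isOpen φ.open_source hy]
  rfl

/-- The coordinate expression of the vector field `ρ^k_α ∂/∂z^k`. -/
noncomputable def anchorField (φ : OpenPartialHomeomorph M (CModel n)) (e : Fin m → ∀ x, E x)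
    (α : Fin m) (p : CModel n × CModel m) : CModel n × CModel m :=
  (L.anchorVec φ e α (φ.symm p.1), 0)

theorem contDiffAt_anchorVec_symm (hφ : φ ∈ IsManifold.maximalAtlas 𝓘(ℂ, CModel n) ω M)
    (he : IsLocalFrameOn 𝓘(ℂ, CModel n) (CModel m) ω e φ.source) (α : Fin m)
    {x : M} (hx : x ∈ φ.source) :
    ContDiffAt ℂ ω (fun z => L.anchorVec φ e α (φ.symm z)) (φ x) := by
  rw [← contMDiffAt_iff_contDiffAt]
  refine ContMDiffAt.comp_of_eq (I' := 𝓘(ℂ, CModel n)) (L.contMDiffAt_anchorVec hφ he α hx)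
    (contMDiffAt_symm_of_mem_maximalAtlas hφ (φ.map_source hx)) (φ.left_inv hx)

theorem contDiffAt_anchorField (hφ : φ ∈ IsManifold.maximalAtlas 𝓘(ℂ, CModel n) ω M)
    (he : IsLocalFrameOn 𝓘(ℂ, CModel n) (CModel m) ω e φ.source) (α : Fin m)
    {u : TotalSpace (CModel m) E} (hu : u.proj ∈ φ.source) :
    ContDiffAt ℂ ω (L.anchorField φ e α) (bundleCoord he u) := by
  refine ContDiffAt.prodMk ?_ contDiffAt_const
  exact ContDiffAt.comp (bundleCoord he u) (L.contDiffAt_anchorVec_symm hφ he α hu) contDiffAt_fst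

/-- The anchor coefficients are functions on the base, so the vertical part `w` of the direction
plays no role and the chain rule through `φ` returns a derivative on `M`. -/
theorem fderiv_anchorField (hφ : φ ∈ IsManifold.maximalAtlas 𝓘(ℂ, CModel n) ω M)
    (he : IsLocalFrameOn 𝓘(ℂ, CModel n) (CModel m) ω e φ.source) (α : Fin m)
    {u : TotalSpace (CModel m) E} (hu : u.proj ∈ φ.source)
    (v : TangentSpace 𝓘(ℂ, CModel n) u.proj) (w : CModel m) :
    fderiv ℂ (L.anchorField φ e α) (bundleCoord he u) (vecDeriv φ u.proj v, w)
      = (vecDeriv (L.anchorVec φ e α) u.proj v, 0) := by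
  set g : CModel n → CModel n := fun z => L.anchorVec φ e α (φ.symm z) with hg
  have hgd : DifferentiableAt ℂ g (φ u.proj) :=
    (L.contDiffAt_anchorVec_symm hφ he α hu).differentiableAt (by simp)
  have h1 : HasFDerivAt (L.anchorField φ e α)
      (((fderiv ℂ g (φ u.proj)).comp (ContinuousLinearMap.fst ℂ (CModel n) (CModel m))).prod 0)
      (bundleCoord he u) :=
    HasFDerivAt.prodMk (HasFDerivAt.comp (bundleCoord he u) (g := g) hgd.hasFDerivAt
      hasFDerivAt_fst) (hasFDerivAt_const _ _)
  rw [h1.fderiv]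
  refine Prod.ext ?_ rfl
  change fderiv ℂ g (φ u.proj) (vecDeriv φ u.proj v) = vecDeriv (L.anchorVec φ e α) u.proj v
  have hc : MDifferentiableAt 𝓘(ℂ, CModel n) 𝓘(ℂ, CModel n) φ u.proj :=
    (contMDiffAt_of_mem_maximalAtlas hφ hu).mdifferentiableAt (by simp)
  have h2 := mfderiv_comp u.proj hgd.mdifferentiableAt hc
  have h3 : (g ∘ φ) =ᶠ[𝓝 u.proj] L.anchorVec φ e α := by
    filter_upwards [φ.open_source.eventually_mem hu] with y hy
    simp only [hg, Function.comp, φ.left_inv hy]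
  rw [h3.mfderiv_eq, mfderiv_eq_fderiv] at h2
  exact (DFunLike.congr_fun h2 v).symm

theorem fderiv_anchorField_vertical (hφ : φ ∈ IsManifold.maximalAtlas 𝓘(ℂ, CModel n) ω M)
    (he : IsLocalFrameOn 𝓘(ℂ, CModel n) (CModel m) ω e φ.source) (α : Fin m)
    {u : TotalSpace (CModel m) E} (hu : u.proj ∈ φ.source) (w : CModel m) :
    fderiv ℂ (L.anchorField φ e α) (bundleCoord he u) (0, w) = 0 := by
  have := L.fderiv_anchorField hφ he α hu 0 w
  rw [map_zero, map_zero] at this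
  exact this

/-- This is `holDeriv_anchor_bracket` applied to each coordinate function `z^k`, whose derivative
along `ρ(e_γ)` is `ρ^k_γ`. -/
theorem vecDeriv_chart_anchor_bracket (hφ : φ ∈ IsManifold.maximalAtlas 𝓘(ℂ, CModel n) ω M)
    (he : IsLocalFrameOn 𝓘(ℂ, CModel n) (CModel m) ω e φ.source) (α β : Fin m)
    {x : M} (hx : x ∈ φ.source) :
    vecDeriv φ x (L.anchor x (L.bracket (e α) (e β) x))
      = vecDeriv (L.anchorVec φ e β) x (L.anchor x (e α x))
        - vecDeriv (L.anchorVec φ e α) x (L.anchor x (e β x)) := by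
  funext k
  have hφd : ∀ y ∈ φ.source, ContMDiffAt 𝓘(ℂ, CModel n) 𝓘(ℂ, CModel n) ω φ y := fun y hy =>
    contMDiffAt_of_mem_maximalAtlas hφ hy
  have hhol : ∀ γ, IsHolAt n m (e γ) x := fun γ => he.contMDiffAt φ.open_source hx γ
  have hev : ∀ γ, (fun y => holDeriv (fun y => φ y k) y (L.anchor y (e γ y)))
      =ᶠ[𝓝 x] fun y => L.anchorVec φ e γ y k := by
    intro γ
    filter_upwards [φ.open_source.eventually_mem hx] with y hy
    exact holDeriv_apply (n := n) (m := n) ((hφd y hy).mdifferentiableAt (by simp)) k _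
  have hsm : ∀ γ, ContMDiffAt 𝓘(ℂ, CModel n) 𝓘(ℂ) ω
      (fun y => holDeriv (fun y => φ y k) y (L.anchor y (e γ y))) x := fun γ =>
    (contMDiffAt_pi_space.1 (L.contMDiffAt_anchorVec hφ he γ hx) k).congr_of_eventuallyEq (hev γ)
  have hder : ∀ γ (v : TangentSpace 𝓘(ℂ, CModel n) x),
      holDeriv (fun y => holDeriv (fun y => φ y k) y (L.anchor y (e γ y))) x v
      = vecDeriv (L.anchorVec φ e γ) x v k := by
    intro γ v
    rw [← holDeriv_apply (n := n)
      ((L.contMDiffAt_anchorVec hφ he γ hx).mdifferentiableAt (by simp))]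
    exact DFunLike.congr_fun ((hev γ).mfderiv_eq (I := 𝓘(ℂ, CModel n)) (I' := 𝓘(ℂ))) v
  -- The auxiliary nonvanishing section is `e_α` itself.
  have h := L.holDeriv_anchor_bracket (hhol α) (hhol β) (hhol α)
    ((he.linearIndependent hx).ne_zero α) (contMDiffAt_pi_space.1 (hφd x hx) k) (hsm α) (hsm β)
  rw [hder, hder, holDeriv_apply ((hφd x hx).mdifferentiableAt (by simp))] at h
  exact h

end HolLieAlgebroid

end AnchorCoordinates

/-! ### The natural local frame -/

section NaturalFrame

variable {φ : OpenPartialHomeomorph M (CModel n)} {e : Fin m → ∀ x, E x}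

namespace HolLieAlgebroid

variable (L : HolLieAlgebroid n m M E)

/-- The holomorphic vector field `ρ^k_α ∂/∂z^k` on `E`. -/
noncomputable def fieldZ (he : IsLocalFrameOn 𝓘(ℂ, CModel n) (CModel m) ω e φ.source) (α : Fin m)
    (u : TotalSpace (CModel m) E) : TangentSpace (totalModelC n m) u :=
  ∑ k, L.anchorCoeff φ e α k u.proj • partialZ he k u

theorem secZ_eq (he : IsLocalFrameOn 𝓘(ℂ, CModel n) (CModel m) ω e φ.source) (α : Fin m) :
    L.secZ he α = holSection (fun w => e α w.proj) (L.fieldZ he α) := by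
  funext u
  simp only [secZ, holSection, fieldZ, ← Cplx.holₗ_apply, map_sum, map_smul]

theorem fieldZ_eq (hφ : φ ∈ IsManifold.maximalAtlas 𝓘(ℂ, CModel n) ω M)
    (he : IsLocalFrameOn 𝓘(ℂ, CModel n) (CModel m) ω e φ.source) (α : Fin m)
    {u : TotalSpace (CModel m) E} (hu : u.proj ∈ φ.source) :
    L.fieldZ he α u = bundleParamDeriv hφ he hu (L.anchorVec φ e α u.proj, 0) := by
  have h : ∀ k, partialZ he k u = bundleParamDeriv hφ he hu (Pi.single k 1, 0) := fun k => rfl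
  simp only [fieldZ, h, ← map_smul, ← map_sum]
  congr 1
  refine Prod.ext ?_ ?_
  · funext i
    simp only [Prod.fst_sum, Prod.smul_fst, Finset.sum_apply, Pi.smul_apply, Pi.single_apply,
      smul_eq_mul, mul_ite, mul_one, mul_zero, Finset.sum_ite_eq, Finset.mem_univ, if_true]
    rfl
  · simp [Prod.snd_sum]

theorem anchorField_bundleCoord (he : IsLocalFrameOn 𝓘(ℂ, CModel n) (CModel m) ω e φ.source)
    (α : Fin m) {u : TotalSpace (CModel m) E} (hu : u.proj ∈ φ.source) :
    L.anchorField φ e α (bundleCoord he u) = (L.anchorVec φ e α u.proj, 0) := by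
  simp only [anchorField, bundleCoord, φ.left_inv hu]

theorem fieldZ_eventuallyEq (hφ : φ ∈ IsManifold.maximalAtlas 𝓘(ℂ, CModel n) ω M)
    (he : IsLocalFrameOn 𝓘(ℂ, CModel n) (CModel m) ω e φ.source) (α : Fin m)
    {u : TotalSpace (CModel m) E} (hu : u.proj ∈ φ.source) :
    L.fieldZ he α =ᶠ[𝓝 u] coordField he (L.anchorField φ e α) := by
  filter_upwards [eventually_proj (φ.open_source.eventually_mem hu)] with w hw
  rw [L.fieldZ_eq hφ he α hw, coordField_apply hφ he hw, L.anchorField_bundleCoord he α hw]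

theorem projDeriv_fieldZ (hφ : φ ∈ IsManifold.maximalAtlas 𝓘(ℂ, CModel n) ω M)
    (he : IsLocalFrameOn 𝓘(ℂ, CModel n) (CModel m) ω e φ.source) (α : Fin m)
    {u : TotalSpace (CModel m) E} (hu : u.proj ∈ φ.source) :
    projDeriv n m E u (L.fieldZ he α u) = L.anchor u.proj (e α u.proj) := by
  apply vecDeriv_chart_injective hφ hu
  rw [L.fieldZ_eq hφ he α hu, vecDeriv_chart_projDeriv hφ he hu]
  rfl

theorem isHolPair_fieldZ (hφ : φ ∈ IsManifold.maximalAtlas 𝓘(ℂ, CModel n) ω M)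
    (he : IsLocalFrameOn 𝓘(ℂ, CModel n) (CModel m) ω e φ.source) (α : Fin m)
    {u : TotalSpace (CModel m) E} (hu : u.proj ∈ φ.source) :
    IsHolPair he (fun w => e α w.proj) (L.fieldZ he α) u :=
  ⟨mdifferentiableAt_fibreCoord (he.contMDiffAt φ.open_source hu α),
    L.anchorField φ e α, L.contDiffAt_anchorField hφ he α hu, L.fieldZ_eventuallyEq hφ he α hu⟩

end HolLieAlgebroid

theorem secV_eq (he : IsLocalFrameOn 𝓘(ℂ, CModel n) (CModel m) ω e φ.source) (α : Fin m) :
    secV he α = holSection (fun w => (0 : ∀ x, E x) w.proj) (partialU he α) := by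
  funext u
  simp only [secV, holSection, Pi.zero_apply, ← Cplx.holₗ_apply, map_zero]

theorem projDeriv_partialU (hφ : φ ∈ IsManifold.maximalAtlas 𝓘(ℂ, CModel n) ω M)
    (he : IsLocalFrameOn 𝓘(ℂ, CModel n) (CModel m) ω e φ.source) (α : Fin m)
    {u : TotalSpace (CModel m) E} (hu : u.proj ∈ φ.source) :
    projDeriv n m E u (partialU he α u) = 0 := by
  apply vecDeriv_chart_injective hφ hu
  rw [map_zero]
  exact vecDeriv_chart_projDeriv hφ he hu (0, Pi.single α 1)

theorem isHolPair_partialU (he : IsLocalFrameOn 𝓘(ℂ, CModel n) (CModel m) ω e φ.source)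
    (α : Fin m) (u : TotalSpace (CModel m) E) :
    IsHolPair he (fun w => (0 : ∀ x, E x) w.proj) (partialU he α) u :=
  ⟨mdifferentiableAt_fibreCoord (isHolAt_zero n u.proj), fun _ => (0, Pi.single α 1),
    contDiffAt_const, Eventually.of_forall fun _ => rfl⟩

namespace HolLieAlgebroid

section Brackets

variable (L : HolLieAlgebroid n m M E) (hφ : φ ∈ IsManifold.maximalAtlas 𝓘(ℂ, CModel n) ω M)
  (he : IsLocalFrameOn 𝓘(ℂ, CModel n) (CModel m) ω e φ.source) (α β : Fin m)
  {u : TotalSpace (CModel m) E} (hu : u.proj ∈ φ.source)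

include hφ hu

/-- Expanding `[e_α, e_β]` in the frame settles the fibre component. In the vector field component
the coordinate commutator is the coordinate vector of `ρ([e_α, e_β])`, which linearity of the anchor
expands with the same coefficients. -/
theorem realBracket_fieldZ_fieldZ :
    L.realBracket (fun w => e α w.proj) (fun w => e β w.proj) (L.fieldZ he α) (L.fieldZ he β) u
      = (∑ γ, L.structureFn he α β γ u.proj • e γ u.proj,
          ∑ γ, L.structureFn he α β γ u.proj • L.fieldZ he γ u) := by
  have hsum : ∑ γ, L.structureFn he α β γ u.proj • e γ u.proj
      = L.bracket (e α) (e β) u.proj := he.sum_coeff_smul hu _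
  refine Prod.ext ?_ ?_
  · rw [L.realBracket_fst (he.contMDiffAt φ.open_source hu α) (he.contMDiffAt φ.open_source hu β)
      (L.projDeriv_fieldZ hφ he α hu) (L.projDeriv_fieldZ hφ he β hu), hsum]
  · refine (mlieBracket_coordField hφ he hu (L.contDiffAt_anchorField hφ he α hu)
      (L.contDiffAt_anchorField hφ he β hu) (L.fieldZ_eventuallyEq hφ he α hu)
      (L.fieldZ_eventuallyEq hφ he β hu)).trans ?_
    simp only [L.fieldZ_eq hφ he _ hu, L.anchorField_bundleCoord he _ hu, anchorVec,
      L.fderiv_anchorField hφ he _ hu, ← map_smul, ← map_sum]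
    congr 1
    refine Prod.ext ?_ ?_
    · simp only [Prod.fst_sum, Prod.smul_fst, Prod.fst_sub, ← map_smul, ← map_sum, hsum]
      exact (L.vecDeriv_chart_anchor_bracket hφ he α β hu).symm
    · simp [Prod.snd_sum]

theorem realBracket_fieldZ_partialU :
    L.realBracket (fun w => e α w.proj) (fun w => (0 : ∀ x, E x) w.proj)
      (L.fieldZ he α) (partialU he β) u = 0 := by
  have hα := he.contMDiffAt φ.open_source hu α
  refine Prod.ext ?_ ?_
  · rw [L.realBracket_fst hα (isHolAt_zero n u.proj) (L.projDeriv_fieldZ hφ he α hu)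
      ((projDeriv_partialU hφ he β hu).trans (map_zero _).symm), L.bracket_zero_right hα]
    rfl
  · refine (mlieBracket_coordField hφ he hu (L.contDiffAt_anchorField hφ he α hu)
      (contDiffAt_const (c := ((0, Pi.single β 1) : CModel n × CModel m)))
      (L.fieldZ_eventuallyEq hφ he α hu) (Eventually.of_forall fun _ => rfl)).trans ?_
    rw [L.fderiv_anchorField_vertical hφ he α hu]
    simp
    rfl

theorem realBracket_partialU_fieldZ :
    L.realBracket (fun w => (0 : ∀ x, E x) w.proj) (fun w => e β w.proj)
      (partialU he α) (L.fieldZ he β) u = 0 := by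
  have hβ := he.contMDiffAt φ.open_source hu β
  refine Prod.ext ?_ ?_
  · rw [L.realBracket_fst (isHolAt_zero n u.proj) hβ
      ((projDeriv_partialU hφ he α hu).trans (map_zero _).symm) (L.projDeriv_fieldZ hφ he β hu),
      L.bracket_zero_left hβ]
    rfl
  · refine (mlieBracket_coordField hφ he hu
      (contDiffAt_const (c := ((0, Pi.single α 1) : CModel n × CModel m)))
      (L.contDiffAt_anchorField hφ he β hu) (Eventually.of_forall fun _ => rfl)
      (L.fieldZ_eventuallyEq hφ he β hu)).trans ?_
    rw [L.fderiv_anchorField_vertical hφ he β hu]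
    simp
    rfl

theorem realBracket_partialU_partialU :
    L.realBracket (fun w => (0 : ∀ x, E x) w.proj) (fun w => (0 : ∀ x, E x) w.proj)
      (partialU he α) (partialU he β) u = 0 := by
  refine Prod.ext ?_ ?_
  · rw [L.realBracket_fst (isHolAt_zero n u.proj) (isHolAt_zero n u.proj)
      ((projDeriv_partialU hφ he α hu).trans (map_zero _).symm)
      ((projDeriv_partialU hφ he β hu).trans (map_zero _).symm),
      L.bracket_zero_left (isHolAt_zero n u.proj)]
    rfl
  · refine (mlieBracket_coordField hφ he hu
      (contDiffAt_const (c := ((0, Pi.single α 1) : CModel n × CModel m)))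
      (contDiffAt_const (c := ((0, Pi.single β 1) : CModel n × CModel m)))
      (Eventually.of_forall fun _ => rfl) (Eventually.of_forall fun _ => rfl)).trans ?_
    simp
    rfl

theorem prolongBracket_secZ_secZ :
    L.prolongBracket (L.secZ he α) (L.secZ he β) u
      = ∑ γ, L.structureFn he α β γ u.proj • L.secZ he γ u := by
  simp only [L.secZ_eq he]
  rw [L.prolongBracket_hol_hol hφ hu (L.isHolPair_fieldZ hφ he α hu)
    (L.isHolPair_fieldZ hφ he β hu),
    L.realBracket_fieldZ_fieldZ hφ he α β hu]
  simp only [← Cplx.holₗ_apply, map_sum, map_smul, holSection]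
  refine Prod.ext ?_ ?_
  · simp only [Prod.fst_sum, Prod.smul_fst]
  · simp only [Prod.snd_sum, Prod.smul_snd]

theorem prolongBracket_secZ_secV : L.prolongBracket (L.secZ he α) (secV he β) u = 0 := by
  rw [L.secZ_eq he, secV_eq he, L.prolongBracket_hol_hol hφ hu (L.isHolPair_fieldZ hφ he α hu)
    (isHolPair_partialU he β u), L.realBracket_fieldZ_partialU hφ he α β hu]
  simp only [← Cplx.holₗ_apply, Prod.fst_zero, Prod.snd_zero, map_zero]
  rfl

theorem prolongBracket_secV_secZ : L.prolongBracket (secV he α) (L.secZ he β) u = 0 := by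
  rw [L.secZ_eq he, secV_eq he, L.prolongBracket_hol_hol hφ hu (isHolPair_partialU he α u)
    (L.isHolPair_fieldZ hφ he β hu), L.realBracket_partialU_fieldZ hφ he α β hu]
  simp only [← Cplx.holₗ_apply, Prod.fst_zero, Prod.snd_zero, map_zero]
  rfl

theorem prolongBracket_secV_secV : L.prolongBracket (secV he α) (secV he β) u = 0 := by
  rw [secV_eq he, secV_eq he, L.prolongBracket_hol_hol hφ hu (isHolPair_partialU he α u)
    (isHolPair_partialU he β u), L.realBracket_partialU_partialU hφ he α β hu]
  simp only [← Cplx.holₗ_apply, Prod.fst_zero, Prod.snd_zero, map_zero]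
  rfl

end Brackets

theorem secZbar_eq (L : HolLieAlgebroid n m M E)
    (he : IsLocalFrameOn 𝓘(ℂ, CModel n) (CModel m) ω e φ.source) (α : Fin m) :
    L.secZbar he α = fun u => conjFibre (holSection (fun w => e α w.proj) (L.fieldZ he α) u) := by
  funext u
  rw [secZbar, L.secZ_eq he]

end HolLieAlgebroid

theorem secVbar_eq (he : IsLocalFrameOn 𝓘(ℂ, CModel n) (CModel m) ω e φ.source) (α : Fin m) :
    secVbar he α = fun u => conjFibre
      (holSection (fun w => (0 : ∀ x, E x) w.proj) (partialU he α) u) := by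
  funext u
  rw [secVbar, secV_eq he]

theorem conjFibre_zero (u : TotalSpace (CModel m) E) :
    conjFibre (0 : AmbientFibre n m E u) = 0 :=
  Prod.ext Cplx.conj_zero Cplx.conj_zero

theorem conjFibre_sum_smul {u : TotalSpace (CModel m) E} {ι : Type*} (S : Finset ι) (c : ι → ℂ)
    (p : ι → AmbientFibre n m E u) :
    conjFibre (∑ i ∈ S, c i • p i) = ∑ i ∈ S, (starRingEnd ℂ) (c i) • conjFibre (p i) := by
  refine Prod.ext ?_ ?_
  · simp only [conjFibre, Prod.fst_sum, Prod.smul_fst, Cplx.conj_sum, Cplx.conj_smul]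
  · simp only [conjFibre, Prod.snd_sum, Prod.smul_snd, Cplx.conj_sum, Cplx.conj_smul]

/-! ### The natural frame is a basis of the prolongation -/

section Basis

variable (L : HolLieAlgebroid n m M E) (hφ : φ ∈ IsManifold.maximalAtlas 𝓘(ℂ, CModel n) ω M)
  (he : IsLocalFrameOn 𝓘(ℂ, CModel n) (CModel m) ω e φ.source)
  {u : TotalSpace (CModel m) E} (hu : u.proj ∈ φ.source)

theorem HolLieAlgebroid.mem_prolongation_iff (p : AmbientFibre n m E u) :
    p ∈ L.prolongation u ↔
      L.anchor u.proj p.1.re = projDeriv n m E u p.2.re ∧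
      L.anchor u.proj p.1.im = projDeriv n m E u p.2.im := by
  rw [HolLieAlgebroid.prolongation, LinearMap.mem_ker, LinearMap.sub_apply, sub_eq_zero]
  exact Cplx.ext_iff

theorem HolLieAlgebroid.holSection_mem_prolongation {s : ∀ u : TotalSpace (CModel m) E, E u.proj}
    {X : ∀ u : TotalSpace (CModel m) E, TangentSpace (totalModelC n m) u}
    (h : projDeriv n m E u (X u) = L.anchor u.proj (s u)) :
    holSection s X u ∈ L.prolongation u := by
  rw [L.mem_prolongation_iff]
  simp only [holSection, Cplx.hol_eq_ofScalars, Cplx.ofScalars, map_smul, h, and_self]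

theorem HolLieAlgebroid.conjFibre_mem_prolongation {p : AmbientFibre n m E u}
    (h : p ∈ L.prolongation u) : conjFibre p ∈ L.prolongation u := by
  rw [L.mem_prolongation_iff] at h ⊢
  simp only [conjFibre, Cplx.conj, map_neg, h.1, h.2, and_self]

end Basis

end NaturalFrame

section NaturalFrameBasis

variable {φ : OpenPartialHomeomorph M (CModel n)} {e : Fin m → ∀ x, E x}

theorem conjFibre_add {u : TotalSpace (CModel m) E} (p q : AmbientFibre n m E u) :
    conjFibre (p + q) = conjFibre p + conjFibre q :=
  Prod.ext (Cplx.conj_add _ _) (Cplx.conj_add _ _)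

namespace HolLieAlgebroid

variable (L : HolLieAlgebroid n m M E)

theorem sum_smul_secZ_add_sum_smul_secV
    (he : IsLocalFrameOn 𝓘(ℂ, CModel n) (CModel m) ω e φ.source)
    (u : TotalSpace (CModel m) E) (a b : Fin m → ℂ) :
    ∑ α, a α • L.secZ he α u + ∑ α, b α • secV he α u
      = (Cplx.hol (∑ α, a α • e α u.proj),
          Cplx.hol (∑ α, a α • L.fieldZ he α u + ∑ α, b α • partialU he α u)) := by
  simp only [L.secZ_eq he, secV, holSection, ← Cplx.holₗ_apply, map_sum, map_smul, map_add]
  refine Prod.ext ?_ ?_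
  · simp [Prod.fst_sum]
  · simp [Prod.snd_sum]

theorem sum_smul_secZbar_add_sum_smul_secVbar
    (he : IsLocalFrameOn 𝓘(ℂ, CModel n) (CModel m) ω e φ.source)
    (u : TotalSpace (CModel m) E) (c d : Fin m → ℂ) :
    ∑ α, (starRingEnd ℂ) (c α) • L.secZbar he α u + ∑ α, (starRingEnd ℂ) (d α) • secVbar he α u
      = conjFibre (∑ α, c α • L.secZ he α u + ∑ α, d α • secV he α u) := by
  simp only [conjFibre_add, conjFibre_sum_smul, secZbar, secVbar]

theorem sum_smul_partialU_eq (hφ : φ ∈ IsManifold.maximalAtlas 𝓘(ℂ, CModel n) ω M)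
    (he : IsLocalFrameOn 𝓘(ℂ, CModel n) (CModel m) ω e φ.source)
    {u : TotalSpace (CModel m) E} (hu : u.proj ∈ φ.source) (b : Fin m → ℂ) :
    ∑ α, b α • partialU he α u = bundleParamDeriv hφ he hu (0, b) := by
  have h : ∀ α, partialU he α u = bundleParamDeriv hφ he hu (0, Pi.single α 1) := fun α => rfl
  simp only [h, ← map_smul, ← map_sum]
  congr 1
  refine Prod.ext ?_ ?_
  · simp [Prod.fst_sum]
  · funext i
    simp [Prod.snd_sum, Finset.sum_apply, Pi.single_apply]

/-- A vanishing combination splits into its (1,0) and (0,1) parts. In each, the fibre component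
kills the `𝒵` coefficients, after which independence of the `∂/∂u^α` kills the rest. -/
theorem linearIndependent_naturalFrame (hφ : φ ∈ IsManifold.maximalAtlas 𝓘(ℂ, CModel n) ω M)
    (he : IsLocalFrameOn 𝓘(ℂ, CModel n) (CModel m) ω e φ.source)
    {u : TotalSpace (CModel m) E} (hu : u.proj ∈ φ.source) :
    LinearIndependent ℂ (L.naturalFrame he u) := by
  rw [Fintype.linearIndependent_iff]
  intro g hg
  set a : Fin m → ℂ := fun α => g (Sum.inl (Sum.inl α)) with ha
  set b : Fin m → ℂ := fun α => g (Sum.inl (Sum.inr α)) with hb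
  -- Conjugating these coefficients makes the barred half of the sum the conjugate of an unbarred
  -- combination.
  set c : Fin m → ℂ := fun α => (starRingEnd ℂ) (g (Sum.inr (Sum.inl α))) with hc
  set d : Fin m → ℂ := fun α => (starRingEnd ℂ) (g (Sum.inr (Sum.inr α))) with hd
  have hsum := L.sum_smul_secZbar_add_sum_smul_secVbar he u c d
  simp only [hc, hd, Complex.conj_conj] at hsum
  simp only [Fintype.sum_sum_type, naturalFrame, Sum.elim_inl, Sum.elim_inr] at hg
  rw [hsum, L.sum_smul_secZ_add_sum_smul_secV he, L.sum_smul_secZ_add_sum_smul_secV he] at hg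
  have hvanish : ∀ a b : Fin m → ℂ, ∑ α, a α • e α u.proj = 0 →
      ∑ α, a α • L.fieldZ he α u + ∑ α, b α • partialU he α u = 0 → a = 0 ∧ b = 0 := by
    intro a b h1 h2
    have ha : a = 0 := funext (Fintype.linearIndependent_iff.1 (he.linearIndependent hu) a h1)
    refine ⟨ha, ?_⟩
    simp only [ha, Pi.zero_apply, zero_smul, Finset.sum_const_zero, zero_add] at h2
    rw [sum_smul_partialU_eq hφ he hu] at h2
    exact congrArg Prod.snd ((bundleParamDeriv hφ he hu).map_eq_zero_iff.1 h2)
  have h1 := Cplx.eq_zero_of_hol_add_conj_hol (congrArg Prod.fst hg)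
  have h2 := Cplx.eq_zero_of_hol_add_conj_hol (congrArg Prod.snd hg)
  obtain ⟨ha0, hb0⟩ := hvanish _ _ h1.1 h2.1
  obtain ⟨hc0, hd0⟩ := hvanish _ _ h1.2 h2.2
  rintro ((α | α) | (α | α))
  · exact congrFun ha0 α
  · exact congrFun hb0 α
  · exact (map_eq_zero (starRingEnd ℂ)).1 (congrFun hc0 α)
  · exact (map_eq_zero (starRingEnd ℂ)).1 (congrFun hd0 α)

theorem exists_eq_sum_fieldZ_add_sum_partialU
    (hφ : φ ∈ IsManifold.maximalAtlas 𝓘(ℂ, CModel n) ω M)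
    (he : IsLocalFrameOn 𝓘(ℂ, CModel n) (CModel m) ω e φ.source)
    {u : TotalSpace (CModel m) E} (hu : u.proj ∈ φ.source) {x : E u.proj}
    {v : TangentSpace (totalModelC n m) u} (h : L.anchor u.proj x = projDeriv n m E u v) :
    ∃ a b : Fin m → ℂ, x = ∑ α, a α • e α u.proj ∧
      v = ∑ α, a α • L.fieldZ he α u + ∑ α, b α • partialU he α u := by
  set a : Fin m → ℂ := fun α => he.coeff α u.proj x with ha
  have hx : x = ∑ α, a α • e α u.proj := (he.sum_coeff_smul hu x).symm
  set D := bundleParamDeriv hφ he hu with hD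
  set v' := v - ∑ α, a α • L.fieldZ he α u with hv'
  have hproj : projDeriv n m E u v' = 0 := by
    rw [hv', map_sub, map_sum, ← h]
    conv_lhs => rw [hx]
    simp only [map_sum, map_smul, L.projDeriv_fieldZ hφ he _ hu, sub_self]
  -- The remainder `v'` is killed by `π_*`, so its coordinates have no `z`-part; its `u`-part
  -- supplies the coefficients `b`.
  have hfst : (D.symm v').1 = 0 := by
    rw [← vecDeriv_chart_projDeriv hφ he hu (D.symm v'), ← hD, D.apply_symm_apply, hproj, map_zero]
  refine ⟨a, (D.symm v').2, hx, ?_⟩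
  rw [sum_smul_partialU_eq hφ he hu, ← hD]
  have h3 : ((0, (D.symm v').2) : CModel n × CModel m) = D.symm v' := Prod.ext hfst.symm rfl
  rw [h3, D.apply_symm_apply, hv']
  abel

theorem span_naturalFrame (hφ : φ ∈ IsManifold.maximalAtlas 𝓘(ℂ, CModel n) ω M)
    (he : IsLocalFrameOn 𝓘(ℂ, CModel n) (CModel m) ω e φ.source)
    {u : TotalSpace (CModel m) E} (hu : u.proj ∈ φ.source) :
    Submodule.span ℂ (Set.range (L.naturalFrame he u)) = L.prolongation u := by
  have hZ : ∀ α, L.secZ he α u ∈ L.prolongation u := fun α => by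
    rw [L.secZ_eq he]
    exact L.holSection_mem_prolongation (L.projDeriv_fieldZ hφ he α hu)
  have hV : ∀ α, secV he α u ∈ L.prolongation u := fun α => by
    rw [secV_eq he]
    exact L.holSection_mem_prolongation
      ((projDeriv_partialU hφ he α hu).trans (map_zero _).symm)
  refine le_antisymm (Submodule.span_le.2 ?_) ?_
  · rintro _ ⟨(α | α) | (α | α), rfl⟩
    · exact hZ α
    · exact hV α
    · exact L.conjFibre_mem_prolongation (hZ α)
    · exact L.conjFibre_mem_prolongation (hV α)
  · intro p hp
    rw [L.mem_prolongation_iff] at hp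
    obtain ⟨x, y, hxy⟩ := Cplx.exists_hol_add_conj_hol p.1
    obtain ⟨v, w, hvw⟩ := Cplx.exists_hol_add_conj_hol p.2
    -- Since `ρ` and `π_*` are complex linear, the defining equation of the prolongation separates
    -- into one equation for each type, by uniqueness of the decomposition.
    have hdiff : L.anchor u.proj x - projDeriv n m E u v = 0 ∧
        L.anchor u.proj y - projDeriv n m E u w = 0 := by
      apply Cplx.eq_zero_of_hol_add_conj_hol
      rw [hxy, hvw] at hp
      simp only [Cplx.conj_hol_eq_ofScalars] at hp ⊢
      simp only [Cplx.hol_eq_ofScalars, Cplx.ofScalars, Cplx.add_re, Cplx.add_im, map_add,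
        map_smul] at hp ⊢
      ext
      · change (1 / 2 : ℂ) • _ + (1 / 2 : ℂ) • _ = 0
        linear_combination (norm := module) hp.1
      · change (-(Complex.I / 2)) • _ + (Complex.I / 2) • _ = 0
        linear_combination (norm := module) hp.2
    obtain ⟨a, b, hx, hv⟩ :=
      L.exists_eq_sum_fieldZ_add_sum_partialU hφ he hu (sub_eq_zero.1 hdiff.1)
    obtain ⟨c, d, hy, hw⟩ :=
      L.exists_eq_sum_fieldZ_add_sum_partialU hφ he hu (sub_eq_zero.1 hdiff.2)
    have hp' : p = (∑ α, a α • L.secZ he α u + ∑ α, b α • secV he α u)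
        + (∑ α, (starRingEnd ℂ) (c α) • L.secZbar he α u
          + ∑ α, (starRingEnd ℂ) (d α) • secVbar he α u) := by
      rw [L.sum_smul_secZbar_add_sum_smul_secVbar he, L.sum_smul_secZ_add_sum_smul_secV he,
        L.sum_smul_secZ_add_sum_smul_secV he, ← hx, ← hy, ← hv, ← hw]
      exact Prod.ext hxy hvw
    have hmem : ∀ i, L.naturalFrame he u i
        ∈ Submodule.span ℂ (Set.range (L.naturalFrame he u)) := fun i =>
      Submodule.subset_span ⟨i, rfl⟩
    rw [hp']
    refine add_mem (add_mem ?_ ?_) (add_mem ?_ ?_)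
    · exact sum_mem fun α _ => Submodule.smul_mem _ _ (hmem (Sum.inl (Sum.inl α)))
    · exact sum_mem fun α _ => Submodule.smul_mem _ _ (hmem (Sum.inl (Sum.inr α)))
    · exact sum_mem fun α _ => Submodule.smul_mem _ _ (hmem (Sum.inr (Sum.inl α)))
    · exact sum_mem fun α _ => Submodule.smul_mem _ _ (hmem (Sum.inr (Sum.inr α)))

end HolLieAlgebroid

end NaturalFrameBasis

end ProlongationFrame

/-! ### The basis statement and the bracket relations together -/

theorem proposition1p1 {n m : ℕ}
    {M : Type*} [TopologicalSpace M] [ChartedSpace (CModel n) M]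
    [IsManifold 𝓘(ℂ, CModel n) ω M]
    {E : M → Type*} [TopologicalSpace (TotalSpace (CModel m) E)]
    [∀ x, AddCommGroup (E x)] [∀ x, Module ℂ (E x)] [∀ x, TopologicalSpace (E x)]
    [FiberBundle (CModel m) E] [VectorBundle ℂ (CModel m) E]
    [ContMDiffVectorBundle ω (CModel m) E 𝓘(ℂ, CModel n)]
    (L : HolLieAlgebroid n m M E)
    (φ : OpenPartialHomeomorph M (CModel n))
    (hφ : φ ∈ IsManifold.maximalAtlas 𝓘(ℂ, CModel n) ω M)
    (e : Fin m → ∀ x, E x)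
    (he : IsLocalFrameOn 𝓘(ℂ, CModel n) (CModel m) ω e φ.source)
    (u : TotalSpace (CModel m) E) (hu : u.proj ∈ φ.source) :
    -- the sections form a basis of the fibre of the complexified prolongation at `u`
    (LinearIndependent ℂ (L.naturalFrame he u) ∧
      Submodule.span ℂ (Set.range (L.naturalFrame he u)) = L.prolongation u) ∧
    ∀ α β : Fin m,
      L.prolongBracket (L.secZ he α) (L.secZ he β) u
        = ∑ γ, L.structureFn he α β γ u.proj • L.secZ he γ u ∧
      L.prolongBracket (L.secZ he α) (secV he β) u = 0 ∧
      L.prolongBracket (secV he α) (secV he β) u = 0 ∧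
      L.prolongBracket (L.secZ he α) (L.secZbar he β) u = 0 ∧
      L.prolongBracket (L.secZ he α) (secVbar he β) u = 0 ∧
      L.prolongBracket (secV he α) (secVbar he β) u = 0 ∧
      -- the conjugate relations
      L.prolongBracket (L.secZbar he α) (L.secZbar he β) u
        = conjFibre (L.prolongBracket (L.secZ he α) (L.secZ he β) u) ∧
      L.prolongBracket (L.secZbar he α) (L.secZbar he β) u
        = ∑ γ, (starRingEnd ℂ) (L.structureFn he α β γ u.proj) • L.secZbar he γ u ∧
      L.prolongBracket (L.secZbar he α) (secVbar he β) u = 0 ∧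
      L.prolongBracket (secVbar he α) (secVbar he β) u = 0 ∧
      L.prolongBracket (L.secZbar he α) (L.secZ he β) u = 0 ∧
      L.prolongBracket (L.secZbar he α) (secV he β) u = 0 ∧
      L.prolongBracket (secVbar he α) (secV he β) u = 0 ∧
      -- the same brackets in the opposite order
      L.prolongBracket (secV he α) (L.secZ he β) u = 0 ∧
      L.prolongBracket (secVbar he α) (L.secZ he β) u = 0 ∧
      L.prolongBracket (secV he α) (L.secZbar he β) u = 0 ∧
      L.prolongBracket (secVbar he α) (L.secZbar he β) u = 0 := by
  refine ⟨⟨L.linearIndependent_naturalFrame hφ he hu, L.span_naturalFrame hφ he hu⟩, fun α β => ?_⟩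
  have hZ := fun α => L.isHolPair_fieldZ hφ he α hu
  have hV := fun α => isHolPair_partialU he α u
  have hZZ := L.prolongBracket_secZ_secZ hφ he α β hu
  have hZV := L.prolongBracket_secZ_secV hφ he α β hu
  have hVZ := L.prolongBracket_secV_secZ hφ he α β hu
  have hVV := L.prolongBracket_secV_secV hφ he α β hu
  have hconj : L.prolongBracket (L.secZbar he α) (L.secZbar he β) u
      = conjFibre (L.prolongBracket (L.secZ he α) (L.secZ he β) u) := by
    rw [L.secZbar_eq, L.secZbar_eq, L.secZ_eq, L.secZ_eq]
    exact L.prolongBracket_conj_conj hφ hu (hZ α) (hZ β)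
  refine ⟨hZZ, hZV, hVV, ?_, ?_, ?_, hconj, ?_, ?_, ?_, ?_, ?_, ?_, hVZ, ?_, ?_, ?_⟩
  · rw [L.secZbar_eq, L.secZ_eq]
    exact L.prolongBracket_hol_conj hφ hu (hZ α) (hZ β)
  · rw [secVbar_eq, L.secZ_eq]
    exact L.prolongBracket_hol_conj hφ hu (hZ α) (hV β)
  · rw [secVbar_eq, secV_eq]
    exact L.prolongBracket_hol_conj hφ hu (hV α) (hV β)
  · rw [hconj, hZZ, conjFibre_sum_smul]
    rfl
  · rw [secVbar_eq, L.secZbar_eq, L.prolongBracket_conj_conj hφ hu (hZ α) (hV β), ← L.secZ_eq,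
      ← secV_eq, hZV, conjFibre_zero]
  · rw [secVbar_eq, secVbar_eq, L.prolongBracket_conj_conj hφ hu (hV α) (hV β), ← secV_eq,
      ← secV_eq, hVV, conjFibre_zero]
  · rw [L.secZbar_eq, L.secZ_eq]
    exact L.prolongBracket_conj_hol hφ hu (hZ α) (hZ β)
  · rw [L.secZbar_eq, secV_eq]
    exact L.prolongBracket_conj_hol hφ hu (hZ α) (hV β)
  · rw [secVbar_eq, secV_eq]
    exact L.prolongBracket_conj_hol hφ hu (hV α) (hV β)
  · rw [secVbar_eq, L.secZ_eq]
    exact L.prolongBracket_conj_hol hφ hu (hV α) (hZ β)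
  · rw [L.secZbar_eq, secV_eq]
    exact L.prolongBracket_hol_conj hφ hu (hV α) (hZ β)
  · rw [secVbar_eq, L.secZbar_eq, L.prolongBracket_conj_conj hφ hu (hV α) (hZ β), ← L.secZ_eq,
      ← secV_eq, hVZ, conjFibre_zero]
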